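/- **Setting.** For $U:[c,d]\times[c,d]\to E$ ($E$ a Banach space) the Kurzweil integral $\int_c^d DU(\tau,\gamma)$ is the limit, over gauge-fine tagged divisions $(\tau_j,[t_{j-1},t_j])$ of $[c,d]$, of the sums $\sum_j [U(\tau_j,t_j)-U(\tau_j,t_{j-1})]$. Write $\int_c^d d[A(\sigma)]g(\sigma)$ for the case $U(\tau,\gamma)=A(\gamma)g(\tau)$, and $\int_t^\infty=\lim_{T\to\infty}\int_t^T$. Let $\mathscr Z$ be a Banach space and $\Lambda:\mathbb R\to\mathscr B(\mathscr Z)$. Assume: * (H1) for all $t$ the operators $\mathrm{Id}+(\Lambda(t^+)-\Lambda(t))$ and $\mathrm{Id}-(\Lambda(t)-\Lambda(t^-))$ have bounded inverses of norm at most $C_a$ (a constant $C_a>0$), and there is a finite constant $V_\Lambda$ with $\mathrm{var}_c^d\Lambda\le V_\Lambda$ whenever $0<d-c\le 1$ (this holds in particular when $\sup_{c<d}\mathrm{var}_c^d\Lambda\le V_\Lambda$). * Let $\mathscr V(t,s)$ be the fundamental operator of $\frac{dz}{d\tau}=D[\Lambda(t)z]$: $\mathscr V(t,s)=\mathrm{Id}+\int_s^t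 d[\Lambda(r)]\mathscr V(r,s)$ for all $t,s\in\mathbb R$, with $\mathscr V(\cdot,s)$ of locally bounded variation. The equation has an exponential dichotomy on $\mathbb R$: there are bounded projections $P(t)$ with $P(t)\mathscr V(t,s)=\mathscr V(t,s)P(s)$ and constants $K,\alpha>0$ with $\|\mathscr V(t,s)P(s)\|\le Ke^{-\alpha(t-s)}$ for $t\ge s$ and $\|\mathscr V(t,s)(\mathrm{Id}-P(s))\|\le Ke^{\alpha(t-s)}$ for $t<s$. Put $\mathscr E^s(s)=P(s)\mathscr Z$. * (H2) $F:\mathscr Z\times\mathbb R\to\mathscr Z$ satisfies $F(0,t)=0$ and there is a nondecreasing $h:\mathbb R\to\mathbb R$ with $\|F(z,t_2)-F(z,t_1)\|\le|h(t_2)-h(t_1)|$, $\|F(z,t_2)-F(z,t_1)-F(w,t_2)+F(w,t_1)\|\le\|z-w\|\,|h(t_2)-h(t_1)|$ for all $z,w,t_1,t_2$, and $V_h:=\sup_{c<d}\mathrm{var}_c^d h<\infty$. For $s\in\mathbb R$, $\zeta\in\mathscr E^s(s)$ and $z:[s,\infty)\to\mathscr Z$ put, whenever the integrals exist, $f_z(\sigma)=\int_s^\sigma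 DF(z(\tau),\gamma)$ and $$(\mathscr J_\zeta z)(t)=\mathscr V(t,s)P(s)\zeta+f_z(t)-\int_s^t d_\sigma[\mathscr V(t,\sigma)P(\sigma)]f_z(\sigma)+\int_t^\infty d_\sigma[\mathscr V(t,\sigma)(\mathrm{Id}-P(\sigma))]f_z(\sigma),\qquad t\ge s.$$ The Lyapunov–Perron equation is $z(t)=(\mathscr J_{z(s)}z)(t)$, $t\ge s$; a solution is a function for which all these integrals exist and the equality holds. **Lemma.** Given $K,\alpha,C_a,V_\Lambda$ there are $\varepsilon>0$, $q\in[0,1)$ and $L\ge0$, depending only on these numbers, such that under the assumptions above with $V_h<\varepsilon$: 1. for all $s\in\mathbb R$ and $\zeta\in\mathscr E^s(s)$, $\mathscr J_\zeta$ maps the space of bounded regulated functions $[s,\infty)\to\mathscr Z$ (functions having one-sided limits) into itself and is a contraction in the supremum norm with constant $q$; 2. for all $s\in\mathbb R$ and $\zeta\in\mathscr E^s(s)$ the Lyapunov–Perron equation with $P(s)z(s)=\zeta$ has exactly one bounded solution $t\mapsto\phi_t(s,\zeta)$ on $[s,\infty)$; it is regulated and is the fixed point of $\mathscr J_\zeta$;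 3. $\phi_t(s,0)=0$ for all $t\ge s$, and $\|\phi_t(s,\zeta_1)-\phi_t(s,\zeta_2)\|\le L\|\zeta_1-\zeta_2\|$ for all $t\ge s$ and $\zeta_1,\zeta_2\in\mathscr E^s(s)$. -/

import Mathlib

open Set Filter Topology
open scoped ENNReal NNReal

namespace GODE

section Kurzweil

variable {E : Type*} [NormedAddCommGroup E]

/-- `c = t 0 ≤ t 1 ≤ ⋯ ≤ t n = d`, with tags `ξ i ∈ [t i, t (i+1)]`, is a `δ`-fine tagged division
of `[c, d]`: `[t i, t (i+1)] ⊆ (ξ i - δ (ξ i), ξ i + δ (ξ i))` for all `i < n`. -/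
structure IsFineDivision (δ : ℝ → ℝ) (c d : ℝ) (n : ℕ) (t ξ : ℕ → ℝ) : Prop where
  left : t 0 = c
  right : t n = d
  mono : ∀ i < n, t i ≤ t (i + 1)
  tag : ∀ i < n, ξ i ∈ Icc (t i) (t (i + 1))
  fine : ∀ i < n, Icc (t i) (t (i + 1)) ⊆ Ioo (ξ i - δ (ξ i)) (ξ i + δ (ξ i))

/-- For `c ≤ d`: the Kurzweil integral `∫_c^d D U(τ, γ)` exists and equals `J`. The first argument
of `U` is the tag `τ`, the second is the division point `γ`. -/
def HasKurzweilIntegral (U : ℝ → ℝ → E) (c d : ℝ) (J : E) : Prop :=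
  ∀ ε > 0, ∃ δ : ℝ → ℝ, (∀ x, 0 < δ x) ∧
    ∀ (n : ℕ) (t ξ : ℕ → ℝ), IsFineDivision δ c d n t ξ →
      ‖(∑ i ∈ Finset.range n, (U (ξ i) (t (i + 1)) - U (ξ i) (t i))) - J‖ < ε

/-- The oriented integral `∫_s^t D U(τ, γ)`, for `s ≤ t` or `t ≤ s`, with `∫_s^t = -∫_t^s`. -/
def HasOrientedKurzweilIntegral (U : ℝ → ℝ → E) (s t : ℝ) (J : E) : Prop :=
  (s ≤ t → HasKurzweilIntegral U s t J) ∧ (t ≤ s → HasKurzweilIntegral U t s (-J))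

/-- The improper integral `∫_c^∞ D U(τ, γ) = lim_{T → ∞} ∫_c^T D U(τ, γ)` exists and equals `J`. -/
def HasImproperKurzweilIntegral (U : ℝ → ℝ → E) (c : ℝ) (J : E) : Prop :=
  ∃ g : ℝ → E, (∀ T, c ≤ T → HasKurzweilIntegral U c T (g T)) ∧ Tendsto g atTop (𝓝 J)

/-- The supremum of `var_c^d g` over all `c < d`. -/
noncomputable def totalVariation (g : ℝ → E) : ℝ≥0∞ :=
  ⨆ (c : ℝ) (d : ℝ) (_ : c < d), eVariationOn g (Icc c d)

/-- The supremum of `var_c^d g` over all `c < d` with `d - c ≤ 1`. -/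
noncomputable def unitVariation (g : ℝ → E) : ℝ≥0∞ :=
  ⨆ (c : ℝ) (d : ℝ) (_ : c < d) (_ : d - c ≤ 1), eVariationOn g (Icc c d)

/-- Finite global variation controls the variation over intervals of length at most one. -/
theorem unitVariation_le_totalVariation (g : ℝ → E) : unitVariation g ≤ totalVariation g :=
  iSup_mono fun _ => iSup_mono fun _ => iSup_mono fun _ => iSup_le fun _ => le_rfl

/-- `z` is bounded on `[s, ∞)`. -/
def BoundedFrom (s : ℝ) (z : ℝ → E) : Prop := ∃ M : ℝ, ∀ t, s ≤ t → ‖z t‖ ≤ M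

/-- `z` is regulated on `[s, ∞)`: it has one-sided limits. -/
def RegulatedFrom (s : ℝ) (z : ℝ → E) : Prop :=
  (∀ t, s < t → ∃ l, Tendsto z (𝓝[<] t) (𝓝 l)) ∧ ∀ t, s ≤ t → ∃ l, Tendsto z (𝓝[>] t) (𝓝 l)

end Kurzweil

section Equation

variable {Z : Type*} [NormedAddCommGroup Z] [NormedSpace ℝ Z]

/-- `V` is the fundamental operator of `dz/dτ = D[Λ(t) z]`:
`V(t, s) = Id + ∫_s^t d[Λ(r)] V(r, s)` for all `t, s`, and `V(·, s)` has locally bounded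
variation. -/
structure IsFundamentalOperator (Λ : ℝ → Z →L[ℝ] Z) (V : ℝ → ℝ → Z →L[ℝ] Z) : Prop where
  integral_eq : ∀ t s, HasOrientedKurzweilIntegral (fun r γ => Λ γ * V r s) s t (V t s - 1)
  bv : ∀ s, LocallyBoundedVariationOn (fun t => V t s) univ

/-- The equation with fundamental operator `V` has an exponential dichotomy on `ℝ` with
(invariant) projections `P t`, bound `K` and exponent `α`. -/
structure IsExpDichotomy (V : ℝ → ℝ → Z →L[ℝ] Z) (P : ℝ → Z →L[ℝ] Z) (K α : ℝ) : Prop where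
  proj : ∀ t, P t * P t = P t
  invariant : ∀ t s, P t * V t s = V t s * P s
  stable : ∀ t s, s ≤ t → ‖V t s * P s‖ ≤ K * Real.exp (-α * (t - s))
  unstable : ∀ t s, t < s → ‖V t s * (1 - P s)‖ ≤ K * Real.exp (α * (t - s))

/-- The stable space at time `s`, the range of `P s`. -/
def stableSpace (P : ℝ → Z →L[ℝ] Z) (s : ℝ) : Submodule ℝ Z :=
  LinearMap.range (P s : Z →ₗ[ℝ] Z)

/-- The operators `Id + (Λ(t⁺) - Λ(t))` and `Id - (Λ(t) - Λ(t⁻))` have bounded inverses, of norm at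
most `Ca`, and `Λ` has variation at most `VΛ` on each interval of length at most one. -/
structure LinearHyp (Λ : ℝ → Z →L[ℝ] Z) (Ca : ℝ) (VΛ : ℝ≥0) : Prop where
  right_isUnit : ∀ t, IsUnit (1 + (Function.rightLim Λ t - Λ t))
  right_bound : ∀ t, ‖Ring.inverse (1 + (Function.rightLim Λ t - Λ t))‖ ≤ Ca
  left_isUnit : ∀ t, IsUnit (1 - (Λ t - Function.leftLim Λ t))
  left_bound : ∀ t, ‖Ring.inverse (1 - (Λ t - Function.leftLim Λ t))‖ ≤ Ca
  variation : unitVariation Λ ≤ VΛ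

/-- The class `𝓕(Z × ℝ, h)`. -/
structure ClassF (F : Z → ℝ → Z) (h : ℝ → ℝ) : Prop where
  mono : Monotone h
  bound : ∀ z t₁ t₂, ‖F z t₂ - F z t₁‖ ≤ |h t₂ - h t₁|
  lipschitz : ∀ z w t₁ t₂, ‖F z t₂ - F z t₁ - F w t₂ + F w t₁‖ ≤ ‖z - w‖ * |h t₂ - h t₁|

/-- `w = 𝒥_ζ z` on `[s, ∞)`, where `𝒥_ζ` is the Lyapunov-Perron operator: all the integrals below
exist and, for all `t ≥ s`,
`w(t) = V(t,s) P(s) ζ + f(t) - ∫_s^t d_σ[V(t,σ) P(σ)] f(σ) + ∫_t^∞ d_σ[V(t,σ) (Id - P(σ))] f(σ)`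
with `f(σ) = ∫_s^σ D F(z(τ), γ)`. -/
def IsLyapunovPerronImage (V : ℝ → ℝ → Z →L[ℝ] Z) (P : ℝ → Z →L[ℝ] Z) (F : Z → ℝ → Z)
    (s : ℝ) (ζ : Z) (z w : ℝ → Z) : Prop :=
  ∃ f : ℝ → Z,
    (∀ σ, s ≤ σ → HasKurzweilIntegral (fun τ γ => F (z τ) γ) s σ (f σ)) ∧
    ∀ t, s ≤ t → ∃ I₁ I₂ : Z,
      HasKurzweilIntegral (fun τ γ => (V t γ * P γ) (f τ)) s t I₁ ∧
      HasImproperKurzweilIntegral (fun τ γ => (V t γ * (1 - P γ)) (f τ)) t I₂ ∧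
      w t = V t s (P s ζ) + f t - I₁ + I₂

/-- `z` is a bounded solution on `[s, ∞)` of the Lyapunov-Perron equation
`z(t) = V(t,s) P(s) z(s) + f(t) - ∫_s^t d_σ[V(t,σ) P(σ)] f(σ) + ∫_t^∞ d_σ[V(t,σ) (Id - P(σ))] f(σ)`,
`f(σ) = ∫_s^σ D F(z(τ), γ)`, with `P(s) z(s) = ζ`. -/
def IsBoundedLyapunovPerronSolution (V : ℝ → ℝ → Z →L[ℝ] Z) (P : ℝ → Z →L[ℝ] Z) (F : Z → ℝ → Z)
    (s : ℝ) (ζ : Z) (z : ℝ → Z) : Prop :=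
  BoundedFrom s z ∧ IsLyapunovPerronImage V P F s (z s) z z ∧ P s (z s) = ζ

end Equation

end GODE

/-! The theorem is Banach's fixed point argument, and everything rests on an estimate of `∫ d[A] f`
that uses only a bound `C` for `‖A‖` and the variation of `f`. Summation by parts on each interval
of a division shows that the integral differs from its boundary terms `A(b)f(b) - A(a)f(a)` by at
most `C` times the increment of a monotone function dominating `f` (`norm_stieltjes_le`). The
dichotomy bounds `V(t,σ)P(σ)` by `K` for `σ ≤ t` and `V(t,σ)(1 - P(σ))` by `1 + K` for `σ ≥ t`, so
the variation of these kernels never enters.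

If `‖z₁ - z₂‖ ≤ M` and `h` has increments at most `ε`, the difference of the two primitives `f`
vanishes at `s` and has size and variation at most `εM`. The three terms containing it contribute `1
+ 3K + 3(1 + K) = 4 + 6K` times `εM` (`IsLyapunovPerronImage.norm_sub_le`). Taking `(4 + 6K)ε = 1/2`
gives contraction constant `1/2` and Lipschitz constant `2K` for the fixed points.

The rest is existence. Integrals are built from a local criterion
(`exists_hasKurzweilIntegral_of_local`), which covers both `∫ DF(z(τ),γ)` with `z` regulated and `∫
d[A] f` with `A` regulated and `f` dominated by a monotone function. That the kernels are regulated
follows from the cocycle law, itself a consequence of uniqueness for the linear equation, where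
invertibility of the jump operators is used. Exponential decay makes the improper integral converge.
Finally, applying `P(s)` at time `s` kills the unstable integral, so fixed points of `𝒥_ζ` with
`P(s)ζ = ζ` are exactly solutions with stable component `ζ`. -/

namespace GODE

/-! ### Riemann sums over fine divisions, and Cousin's lemma -/

section Sums

variable {E : Type*} [NormedAddCommGroup E]

/-- `S` is a Riemann sum of `U` for some `δ`-fine tagged division of `[c, d]`. -/
inductive IsFineSum (δ : ℝ → ℝ) (U : ℝ → ℝ → E) (c : ℝ) : ℝ → E → Prop
  | nil : IsFineSum δ U c c 0
  | snoc {b d τ : ℝ} {S : E} : IsFineSum δ U c b S → b ≤ τ → τ ≤ d →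
      Icc b d ⊆ Ioo (τ - δ τ) (τ + δ τ) → IsFineSum δ U c d (S + (U τ d - U τ b))

variable {δ δ' : ℝ → ℝ} {U : ℝ → ℝ → E} {a b c d : ℝ} {S T I J : E}

theorem IsFineSum.le (h : IsFineSum δ U c d S) : c ≤ d := by
  induction h with
  | nil => exact le_rfl
  | snoc _ h1 h2 _ ih => exact ih.trans (h1.trans h2)

theorem IsFineSum.eq_zero (h : IsFineSum δ U c d S) (hcd : d = c) : S = 0 := by
  induction h with
  | nil => rfl
  | snoc h0 h1 h2 _ ih =>
    have hb := h0.le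
    rw [ih (by linarith), show _ = _ from le_antisymm (h1.trans h2) (by linarith)]
    simp

theorem IsFineSum.mono (h : IsFineSum δ U c d S) (hδ : ∀ x, δ x ≤ δ' x) :
    IsFineSum δ' U c d S := by
  induction h with
  | nil => exact .nil
  | @snoc _ _ τ _ _ h1 h2 h3 ih =>
    exact .snoc ih h1 h2 (h3.trans (Ioo_subset_Ioo (by linarith [hδ τ]) (by linarith [hδ τ])))

theorem IsFineSum.append (h : IsFineSum δ U a b S) (h' : IsFineSum δ U b c T) :
    IsFineSum δ U a c (S + T) := by
  induction h' with
  | nil => simpa using h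
  | snoc _ h1 h2 h3 ih => rw [← add_assoc]; exact .snoc ih h1 h2 h3

theorem isFineSum_single {τ : ℝ} (h1 : a ≤ τ) (h2 : τ ≤ b)
    (h3 : Icc a b ⊆ Ioo (τ - δ τ) (τ + δ τ)) : IsFineSum δ U a b (U τ b - U τ a) := by
  simpa using IsFineSum.snoc (U := U) .nil h1 h2 h3

theorem IsFineDivision.isFineSum {n : ℕ} {t ξ : ℕ → ℝ} (h : IsFineDivision δ c d n t ξ) :
    IsFineSum δ U c d (∑ i ∈ Finset.range n, (U (ξ i) (t (i + 1)) - U (ξ i) (t i))) := by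
  induction n generalizing d with
  | zero =>
    have : c = d := h.left.symm.trans h.right
    subst this
    simpa using IsFineSum.nil
  | succ n ih =>
    rw [Finset.sum_range_succ]
    have h1 : IsFineDivision δ c (t n) n t ξ :=
      ⟨h.left, rfl, fun i hi => h.mono i (by omega), fun i hi => h.tag i (by omega),
        fun i hi => h.fine i (by omega)⟩
    rw [show U (ξ n) (t (n + 1)) = U (ξ n) d by rw [h.right]]
    have h2 := h.tag n (by omega)
    have h3 := h.fine n (by omega)
    rw [h.right] at h2 h3
    exact .snoc (ih h1) h2.1 h2.2 h3

theorem IsFineSum.exists_division (h : IsFineSum δ U c d S) :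
    ∃ (n : ℕ) (t ξ : ℕ → ℝ), IsFineDivision δ c d n t ξ ∧
      S = ∑ i ∈ Finset.range n, (U (ξ i) (t (i + 1)) - U (ξ i) (t i)) := by
  induction h with
  | nil => exact ⟨0, fun _ => c, fun _ => c, ⟨rfl, rfl, by simp, by simp, by simp⟩, by simp⟩
  | @snoc b d τ S h0 h1 h2 h3 ih =>
    obtain ⟨n, t, ξ, hD, rfl⟩ := ih
    have hval : ∀ i < n, (if i + 1 ≤ n then t (i + 1) else d) = t (i + 1) :=
      fun i hi => if_pos (by omega)
    have hval' : ∀ i < n, (if i ≤ n then t i else d) = t i := fun i hi => if_pos (by omega)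
    have hξ : ∀ i < n, (if i < n then ξ i else τ) = ξ i := fun i hi => if_pos hi
    refine ⟨n + 1, fun i => if i ≤ n then t i else d, fun i => if i < n then ξ i else τ,
      ⟨by simp [hD.left], by simp, ?_, ?_, ?_⟩, ?_⟩
    · intro i hi
      rcases Nat.lt_succ_iff_lt_or_eq.mp hi with hi | rfl
      · simp only [hval i hi, hval' i hi]; exact hD.mono i hi
      · simp [hD.right, h1.trans h2]
    · intro i hi
      rcases Nat.lt_succ_iff_lt_or_eq.mp hi with hi | rfl
      · simp only [hval i hi, hval' i hi, hξ i hi]; exact hD.tag i hi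
      · simp [hD.right, h1, h2]
    · intro i hi
      rcases Nat.lt_succ_iff_lt_or_eq.mp hi with hi | rfl
      · simp only [hval i hi, hval' i hi, hξ i hi]; exact hD.fine i hi
      · simpa [hD.right] using h3
    · rw [Finset.sum_range_succ]
      congr 1
      · refine Finset.sum_congr rfl fun i hi => ?_
        have hi := Finset.mem_range.mp hi
        simp only [hval i hi, hval' i hi, hξ i hi]
      · simp [hD.right]

/-- Sums built by adding intervals on the right allow structural induction in place of index
manipulations. -/
theorem hasKurzweilIntegral_iff : HasKurzweilIntegral U c d J ↔
    ∀ ε > 0, ∃ δ : ℝ → ℝ, (∀ x, 0 < δ x) ∧ ∀ S, IsFineSum δ U c d S → ‖S - J‖ < ε := by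
  refine forall₂_congr fun ε _ => exists_congr fun δ => and_congr_right fun _ => ⟨?_, ?_⟩
  · intro h S hS
    obtain ⟨n, t, ξ, hD, rfl⟩ := hS.exists_division
    exact h n t ξ hD
  · intro h n t ξ hD
    exact h _ hD.isFineSum

/-- The gauge forces any interval containing `b` to have tag `b`. Cutting such an interval at `b`
keeps the tag on both pieces, and the increments of `U b` telescope. -/
theorem IsFineSum.split {δ₀ : ℝ → ℝ} (hb : ∀ x, x ≠ b → δ₀ x ≤ |x - b|)
    (h : IsFineSum δ₀ U a d S) (hab : a ≤ b) :
    b ≤ d → ∃ S₁ S₂, IsFineSum δ₀ U a b S₁ ∧ IsFineSum δ₀ U b d S₂ ∧ S = S₁ + S₂ := by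
  induction h with
  | nil =>
    intro hba
    obtain rfl := le_antisymm hab hba
    exact ⟨0, 0, .nil, .nil, by simp⟩
  | @snoc d' d τ S h0 h1 h2 h3 ih =>
    intro hbd
    rcases le_or_gt b d' with hd | hd
    · obtain ⟨S₁, S₂, i1, i2, rfl⟩ := ih hd
      exact ⟨S₁, _, i1, .snoc i2 h1 h2 h3, by abel⟩
    · have hbm := h3 ⟨hd.le, hbd⟩
      have hτ : τ = b := by
        by_contra hne
        have h4 := hb τ hne
        rcases abs_cases (τ - b) with h | h <;> rw [h.1] at h4 <;> linarith [hbm.1, hbm.2]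
      subst hτ
      exact ⟨_, _, .snoc h0 h1 le_rfl ((Icc_subset_Icc le_rfl hbd).trans h3),
        isFineSum_single le_rfl hbd ((Icc_subset_Icc hd.le le_rfl).trans h3), by abel⟩

/-- Additive interval properties that hold for small one-sided intervals hold for all intervals. -/
theorem interval_induction {Q : ℝ → ℝ → Prop} (refl : ∀ x, Q x x)
    (trans : ∀ a b c, a ≤ b → b ≤ c → Q a b → Q b c → Q a c)
    (right : ∀ x, ∀ᶠ y in 𝓝[>] x, Q x y) (left : ∀ x, ∀ᶠ y in 𝓝[<] x, Q y x)
    (hab : a ≤ b) : Q a b := by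
  set A := {t | t ∈ Icc a b ∧ Q a t} with hA
  have haA : a ∈ A := ⟨⟨le_rfl, hab⟩, refl a⟩
  have hbdd : BddAbove A := ⟨b, fun t ht => ht.1.2⟩
  set x := sSup A
  have hax : a ≤ x := le_csSup hbdd haA
  have hxb : x ≤ b := csSup_le ⟨a, haA⟩ fun t ht => ht.1.2
  have hx : Q a x := by
    obtain ⟨l, hl, hl'⟩ := (mem_nhdsLT_iff_exists_Ioo_subset).1 (left x)
    obtain ⟨t, htA, ht⟩ := exists_lt_of_lt_csSup ⟨a, haA⟩ (show l < x from hl)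
    rcases (le_csSup hbdd htA).lt_or_eq with h | h
    · exact trans a t x htA.1.1 h.le htA.2 (hl' ⟨ht, h⟩)
    · rw [show x = t from h.symm]; exact htA.2
  rcases hxb.lt_or_eq with h | h
  · exfalso
    obtain ⟨u, hu, hu'⟩ := (mem_nhdsGT_iff_exists_Ioo_subset).1 (right x)
    obtain ⟨y, hy1, hy2⟩ := exists_between (lt_min (show x < u from hu) h)
    have hyA : y ∈ A := ⟨⟨hax.trans hy1.le, (hy2.trans_le (min_le_right _ _)).le⟩,
      trans a x y hax hy1.le hx (hu' ⟨hy1, hy2.trans_le (min_le_left _ _)⟩)⟩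
    exact absurd (le_csSup hbdd hyA) (not_le.2 hy1)
  · rwa [← h]

/-- Cousin's lemma. -/
theorem exists_isFineSum (U : ℝ → ℝ → E) (hδ : ∀ x, 0 < δ x) (hab : a ≤ b) :
    ∃ S, IsFineSum δ U a b S := by
  refine interval_induction (Q := fun a b => ∃ S, IsFineSum δ U a b S) (fun x => ⟨0, .nil⟩)
    (fun a b c _ _ ⟨S, hS⟩ ⟨T, hT⟩ => ⟨S + T, hS.append hT⟩) (fun x => ?_) (fun x => ?_) hab
  · filter_upwards [Ioo_mem_nhdsGT (show x < x + δ x by linarith [hδ x])] with y hy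
    exact ⟨_, isFineSum_single le_rfl hy.1.le
      fun z hz => ⟨by linarith [hδ x, hz.1], by linarith [hz.2, hy.2]⟩⟩
  · filter_upwards [Ioo_mem_nhdsLT (show x - δ x < x by linarith [hδ x])] with y hy
    exact ⟨_, isFineSum_single hy.2.le le_rfl
      fun z hz => ⟨by linarith [hz.1, hy.1], by linarith [hδ x, hz.2]⟩⟩

theorem IsFineSum.norm_sub_le {H : ℝ → ℝ} {G : ℝ → E} (h : IsFineSum δ U c d S)
    (hU : ∀ u τ v, c ≤ u → u ≤ τ → τ ≤ v → v ≤ d →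
      ‖U τ v - U τ u - (G v - G u)‖ ≤ H v - H u) :
    ‖S - (G d - G c)‖ ≤ H d - H c := by
  induction h with
  | nil => simp
  | @snoc b d τ S h0 h1 h2 h3 ih =>
    have i1 := ih fun u τ' v g1 g2 g3 g4 => hU u τ' v g1 g2 g3 (by linarith)
    have i2 := hU b τ d h0.le h1 h2 le_rfl
    calc ‖S + (U τ d - U τ b) - (G d - G c)‖
        = ‖(S - (G b - G c)) + (U τ d - U τ b - (G d - G b))‖ := by congr 1; abel
      _ ≤ _ := norm_add_le _ _
      _ ≤ _ := by linarith

/-- Isolates the jump at `x`: the gauge makes `x` the tag of the first nondegenerate interval, and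
degenerate intervals contribute zero. -/
theorem IsFineSum.first_interval {x y : ℝ} (h : IsFineSum δ U x y S)
    (hδ : ∀ τ, τ ≠ x → δ τ ≤ |τ - x|) :
    x < y → ∃ t S', x < t ∧ t < x + δ x ∧ IsFineSum δ U t y S' ∧ S = U x t - U x x + S' := by
  induction h with
  | nil => intro h; exact absurd h (lt_irrefl _)
  | @snoc b d τ S h0 h1 h2 h3 ih =>
    intro hxd
    rcases h0.le.lt_or_eq with h | h
    · obtain ⟨t, S', i1, i2, i3, rfl⟩ := ih h
      exact ⟨t, _, i1, i2, .snoc i3 h1 h2 h3, by abel⟩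
    · subst h
      have hbm := h3 ⟨le_rfl, h1.trans h2⟩
      have hτ : τ = x := by
        by_contra hne
        have h4 := hδ τ hne
        rcases abs_cases (τ - x) with h | h <;> rw [h.1] at h4 <;> linarith [hbm.1, hbm.2]
      subst hτ
      exact ⟨d, 0, hxd, (h3 ⟨hxd.le, le_rfl⟩).2, .nil, by rw [h0.eq_zero rfl]; abel⟩

theorem IsFineSum.last_interval {x y : ℝ} (h : IsFineSum δ U y x S) :
    (∀ τ, τ ≠ x → δ τ ≤ |τ - x|) →
    y < x → ∃ t S', t < x ∧ x - δ x < t ∧ IsFineSum δ U y t S' ∧ S = S' + (U x x - U x t) := by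
  induction h with
  | nil => intro _ h; exact absurd h (lt_irrefl _)
  | @snoc b x τ S h0 h1 h2 h3 ih =>
    intro hδ hyx
    have hbm := h3 ⟨h1.trans h2, le_rfl⟩
    have hτ : τ = x := by
      by_contra hne
      have h4 := hδ τ hne
      rcases abs_cases (τ - x) with h | h <;> rw [h.1] at h4 <;> linarith [hbm.1, hbm.2]
    subst hτ
    rcases h1.lt_or_eq with h | h
    · exact ⟨b, S, h, (h3 ⟨le_rfl, h1⟩).1, h0, rfl⟩
    · subst h
      obtain ⟨t, S', i1, i2, i3, rfl⟩ := ih hδ hyx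
      exact ⟨t, S', i1, i2, i3, by abel⟩

/-- A gauge below two given ones that makes `b` a tag of each interval containing it. -/
theorem exists_gauge (hδ : ∀ x, 0 < δ x) (hδ' : ∀ x, 0 < δ' x) (b : ℝ) :
    ∃ η : ℝ → ℝ, (∀ x, 0 < η x) ∧ (∀ x, η x ≤ δ x) ∧ (∀ x, η x ≤ δ' x) ∧
      ∀ x, x ≠ b → η x ≤ |x - b| := by
  refine ⟨fun x => if x = b then min (δ x) (δ' x) else min (min (δ x) (δ' x)) |x - b|,
    fun x => ?_, fun x => ?_, fun x => ?_, fun x hx => ?_⟩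
  · by_cases h : x = b
    · simp [h, hδ, hδ']
    · simp [h, hδ, hδ', sub_eq_zero]
  · by_cases h : x = b <;> simp [h]
  · by_cases h : x = b <;> simp [h]
  · simp [hx]

end Sums

/-! ### The Kurzweil integral: additivity, primitives and existence -/

section Integral

variable {E : Type*} [NormedAddCommGroup E]
variable {δ δ' : ℝ → ℝ} {U U' : ℝ → ℝ → E} {a b c d : ℝ} {S T I J : E}

theorem HasKurzweilIntegral.unique (h : HasKurzweilIntegral U a b I)
    (h' : HasKurzweilIntegral U a b J) (hab : a ≤ b) : I = J := by
  rw [hasKurzweilIntegral_iff] at h h'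
  refine eq_of_forall_dist_le fun ε hε => ?_
  obtain ⟨δ, hδ, h1⟩ := h (ε / 2) (by linarith)
  obtain ⟨δ', hδ', h2⟩ := h' (ε / 2) (by linarith)
  obtain ⟨S, hS⟩ := exists_isFineSum U (δ := fun x => min (δ x) (δ' x))
    (fun x => lt_min (hδ x) (hδ' x)) hab
  have i1 := h1 S (hS.mono fun x => min_le_left _ _)
  have i2 := h2 S (hS.mono fun x => min_le_right _ _)
  rw [dist_eq_norm, show I - J = (S - J) - (S - I) by abel]
  linarith [norm_sub_le (S - J) (S - I)]

theorem hasKurzweilIntegral_self (U : ℝ → ℝ → E) (a : ℝ) : HasKurzweilIntegral U a a 0 := by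
  rw [hasKurzweilIntegral_iff]
  intro ε hε
  refine ⟨fun _ => 1, fun _ => one_pos, fun S hS => ?_⟩
  simpa [hS.eq_zero rfl] using hε

theorem HasKurzweilIntegral.congr (h : HasKurzweilIntegral U a b J)
    (hU : ∀ τ ∈ Icc a b, ∀ γ ∈ Icc a b, U τ γ = U' τ γ) : HasKurzweilIntegral U' a b J := by
  rw [hasKurzweilIntegral_iff] at h ⊢
  intro ε hε
  obtain ⟨δ, hδ, h1⟩ := h ε hε
  refine ⟨δ, hδ, fun S hS => h1 S ?_⟩
  clear h1 h hε
  have : ∀ {d S}, d ≤ b → IsFineSum δ U' a d S → IsFineSum δ U a d S := by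
    intro d S hd h
    induction h with
    | nil => exact .nil
    | snoc h0 h1 h2 h3 ih =>
      have hb := h0.le
      rw [← hU _ ⟨by linarith, by linarith⟩ _ ⟨by linarith, by linarith⟩,
        ← hU _ ⟨by linarith, by linarith⟩ _ ⟨by linarith, by linarith⟩]
      exact .snoc (ih (by linarith)) h1 h2 h3
  exact this le_rfl hS

theorem HasKurzweilIntegral.trans (h : HasKurzweilIntegral U a b I)
    (h' : HasKurzweilIntegral U b c J) (hab : a ≤ b) (hbc : b ≤ c) :
    HasKurzweilIntegral U a c (I + J) := by
  rw [hasKurzweilIntegral_iff] at h h' ⊢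
  intro ε hε
  obtain ⟨δ, hδ, h1⟩ := h (ε / 2) (by linarith)
  obtain ⟨δ', hδ', h2⟩ := h' (ε / 2) (by linarith)
  obtain ⟨η, hη, hη1, hη2, hη3⟩ := exists_gauge hδ hδ' b
  refine ⟨η, hη, fun S hS => ?_⟩
  obtain ⟨S₁, S₂, i1, i2, rfl⟩ := hS.split hη3 hab hbc
  have i1 := h1 _ (i1.mono hη1)
  have i2 := h2 _ (i2.mono hη2)
  rw [show S₁ + S₂ - (I + J) = (S₁ - I) + (S₂ - J) by abel]
  linarith [norm_add_le (S₁ - I) (S₂ - J)]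

/-- Any fine division of `[b, c]` can be prefixed by a fine division of `[a, b]`, whose sum is
already close to `I`. -/
theorem HasKurzweilIntegral.sub_left (h : HasKurzweilIntegral U a b I)
    (h' : HasKurzweilIntegral U a c J) (hab : a ≤ b) :
    HasKurzweilIntegral U b c (J - I) := by
  rw [hasKurzweilIntegral_iff] at h h' ⊢
  intro ε hε
  obtain ⟨δ, hδ, h1⟩ := h (ε / 2) (by linarith)
  obtain ⟨δ', hδ', h2⟩ := h' (ε / 2) (by linarith)
  refine ⟨fun x => min (δ x) (δ' x), fun x => lt_min (hδ x) (hδ' x), fun S hS => ?_⟩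
  obtain ⟨T, hT⟩ := exists_isFineSum U (δ := fun x => min (δ x) (δ' x))
    (fun x => lt_min (hδ x) (hδ' x)) hab
  have i1 := h1 T (hT.mono fun x => min_le_left _ _)
  have i2 := h2 _ ((hT.append hS).mono fun x => min_le_right _ _)
  rw [show S - (J - I) = (T + S - J) - (T - I) by abel]
  linarith [norm_sub_le (T + S - J) (T - I)]

theorem HasKurzweilIntegral.sub_right (h : HasKurzweilIntegral U b c I)
    (h' : HasKurzweilIntegral U a c J) (hbc : b ≤ c) :
    HasKurzweilIntegral U a b (J - I) := by
  rw [hasKurzweilIntegral_iff] at h h' ⊢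
  intro ε hε
  obtain ⟨δ, hδ, h1⟩ := h (ε / 2) (by linarith)
  obtain ⟨δ', hδ', h2⟩ := h' (ε / 2) (by linarith)
  refine ⟨fun x => min (δ x) (δ' x), fun x => lt_min (hδ x) (hδ' x), fun S hS => ?_⟩
  obtain ⟨T, hT⟩ := exists_isFineSum U (δ := fun x => min (δ x) (δ' x))
    (fun x => lt_min (hδ x) (hδ' x)) hbc
  have i1 := h1 T (hT.mono fun x => min_le_left _ _)
  have i2 := h2 _ ((hS.append hT).mono fun x => min_le_right _ _)
  rw [show S - (J - I) = (S + T - J) - (T - I) by abel]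
  linarith [norm_sub_le (S + T - J) (T - I)]

theorem IsFineSum.map {E' : Type*} [NormedAddCommGroup E'] {V : ℝ → ℝ → E'} (L : E →+ E')
    (hL : ∀ τ u v, V τ v - V τ u = L (U τ v - U τ u)) {S : E'} (h : IsFineSum δ V a b S) :
    ∃ T, IsFineSum δ U a b T ∧ S = L T := by
  induction h with
  | nil => exact ⟨0, .nil, by simp⟩
  | snoc h0 h1 h2 h3 ih =>
    obtain ⟨T, hT, rfl⟩ := ih
    exact ⟨_, .snoc hT h1 h2 h3, by rw [map_add, hL]⟩

theorem HasKurzweilIntegral.map_clm {E' : Type*} [NormedAddCommGroup E'] [NormedSpace ℝ E]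
    [NormedSpace ℝ E'] (L : E →L[ℝ] E') (h : HasKurzweilIntegral U a b J) :
    HasKurzweilIntegral (fun τ γ => L (U τ γ)) a b (L J) := by
  rw [hasKurzweilIntegral_iff] at h ⊢
  intro ε hε
  obtain ⟨δ, hδ, h1⟩ := h (ε / (‖L‖ + 1)) (by positivity)
  refine ⟨δ, hδ, fun S hS => ?_⟩
  obtain ⟨T, hT, rfl⟩ := hS.map (U := U) (L : E →+ E') (by intros; simp)
  have := h1 T hT
  rw [lt_div_iff₀ (by positivity)] at this
  calc ‖L T - L J‖ = ‖L (T - J)‖ := by rw [map_sub]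
    _ ≤ ‖L‖ * ‖T - J‖ := L.le_opNorm _
    _ ≤ ‖T - J‖ * (‖L‖ + 1) := by nlinarith [norm_nonneg (T - J)]
    _ < ε := this

theorem IsFineSum.sub_split (h : IsFineSum δ (fun τ γ => U τ γ - U' τ γ) a b S) :
    ∃ S₁ S₂, IsFineSum δ U a b S₁ ∧ IsFineSum δ U' a b S₂ ∧ S = S₁ - S₂ := by
  induction h with
  | nil => exact ⟨0, 0, .nil, .nil, by simp⟩
  | snoc h0 h1 h2 h3 ih =>
    obtain ⟨S₁, S₂, i1, i2, rfl⟩ := ih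
    exact ⟨_, _, .snoc i1 h1 h2 h3, .snoc i2 h1 h2 h3, by abel⟩

theorem HasKurzweilIntegral.sub (h : HasKurzweilIntegral U a b I)
    (h' : HasKurzweilIntegral U' a b J) :
    HasKurzweilIntegral (fun τ γ => U τ γ - U' τ γ) a b (I - J) := by
  rw [hasKurzweilIntegral_iff] at h h' ⊢
  intro ε hε
  obtain ⟨δ, hδ, h1⟩ := h (ε / 2) (by linarith)
  obtain ⟨δ', hδ', h2⟩ := h' (ε / 2) (by linarith)
  refine ⟨fun x => min (δ x) (δ' x), fun x => lt_min (hδ x) (hδ' x), fun S hS => ?_⟩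
  obtain ⟨S₁, S₂, i1, i2, rfl⟩ := hS.sub_split
  have i1 := h1 _ (i1.mono fun x => min_le_left _ _)
  have i2 := h2 _ (i2.mono fun x => min_le_right _ _)
  rw [show S₁ - S₂ - (I - J) = (S₁ - I) - (S₂ - J) by abel]
  linarith [norm_sub_le (S₁ - I) (S₂ - J)]

theorem HasKurzweilIntegral.norm_sub_le {H : ℝ → ℝ} {G : ℝ → E}
    (h : HasKurzweilIntegral U a b J) (hab : a ≤ b)
    (hU : ∀ u τ v, a ≤ u → u ≤ τ → τ ≤ v → v ≤ b →
      ‖U τ v - U τ u - (G v - G u)‖ ≤ H v - H u) :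
    ‖J - (G b - G a)‖ ≤ H b - H a := by
  rw [hasKurzweilIntegral_iff] at h
  refine le_of_forall_pos_le_add fun ε hε => ?_
  obtain ⟨δ, hδ, h1⟩ := h ε hε
  obtain ⟨S, hS⟩ := exists_isFineSum U hδ hab
  have i1 := h1 S hS
  have i2 := hS.norm_sub_le hU
  rw [show J - (G b - G a) = (S - (G b - G a)) - (S - J) by abel]
  linarith [_root_.norm_sub_le (S - (G b - G a)) (S - J)]

/-- A single-interval version of the Saks-Henstock lemma. -/
theorem exists_gauge_norm_sub_le {f : ℝ → E}
    (h : ∀ u v, u ≤ v → HasKurzweilIntegral U u v (f v - f u)) (a b : ℝ) {ε : ℝ} (hε : 0 < ε) :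
    ∃ δ : ℝ → ℝ, (∀ x, 0 < δ x) ∧ ∀ u τ v, a ≤ u → u ≤ τ → τ ≤ v → v ≤ b →
      Icc u v ⊆ Ioo (τ - δ τ) (τ + δ τ) → ‖U τ v - U τ u - (f v - f u)‖ ≤ ε := by
  rcases le_or_gt a b with hab | hab
  swap
  · exact ⟨fun _ => 1, fun _ => one_pos, fun u τ v h1 h2 h3 h4 => by linarith⟩
  obtain ⟨δ, hδ, hS⟩ := hasKurzweilIntegral_iff.1 (h a b hab) (ε / 3) (by linarith)
  refine ⟨δ, hδ, fun u τ v h1 h2 h3 h4 h5 => ?_⟩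
  obtain ⟨δ₁, hδ₁, hS₁⟩ := hasKurzweilIntegral_iff.1 (h a u h1) (ε / 3) (by linarith)
  obtain ⟨δ₂, hδ₂, hS₂⟩ := hasKurzweilIntegral_iff.1 (h v b h4) (ε / 3) (by linarith)
  obtain ⟨S, i1⟩ := exists_isFineSum U (δ := fun x => min (δ x) (δ₁ x))
    (fun x => lt_min (hδ x) (hδ₁ x)) h1
  obtain ⟨T, i2⟩ := exists_isFineSum U (δ := fun x => min (δ x) (δ₂ x))
    (fun x => lt_min (hδ x) (hδ₂ x)) h4
  have j1 := hS₁ S (i1.mono fun x => min_le_right _ _)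
  have j2 := hS₂ T (i2.mono fun x => min_le_right _ _)
  have j3 := hS _ (((i1.mono fun x => min_le_left _ _).append
    (isFineSum_single h2 h3 h5)).append (i2.mono fun x => min_le_left _ _))
  rw [show U τ v - U τ u - (f v - f u) = (S + (U τ v - U τ u) + T - (f b - f a))
    - (S - (f u - f a)) - (T - (f b - f v)) by abel]
  have k1 := norm_sub_le ((S + (U τ v - U τ u) + T - (f b - f a)) - (S - (f u - f a)))
    (T - (f b - f v))
  have k2 := norm_sub_le (S + (U τ v - U τ u) + T - (f b - f a)) (S - (f u - f a))
  linarith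

/-- A primitive has the same jump at `x` as `U x`: apply the Saks-Henstock estimate to `[x, y]` with
tag `x`. -/
theorem tendsto_primitive_right {f : ℝ → E}
    (h : ∀ u v, u ≤ v → HasKurzweilIntegral U u v (f v - f u)) (x : ℝ) :
    Tendsto (fun y => U x y - U x x - (f y - f x)) (𝓝[>] x) (𝓝 0) := by
  rw [Metric.tendsto_nhds]
  intro ε hε
  obtain ⟨δ, hδ, hS⟩ := exists_gauge_norm_sub_le h x (x + 1) (half_pos hε)
  filter_upwards [Ioo_mem_nhdsGT (show x < x + min 1 (δ x) by linarith [lt_min one_pos (hδ x)])]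
    with y hy
  have h1 := min_le_left 1 (δ x)
  have h2 := min_le_right 1 (δ x)
  rw [dist_zero_right]
  refine (hS x x y le_rfl le_rfl hy.1.le (by linarith [hy.2]) fun z hz =>
    ⟨by linarith [hz.1, hδ x], by linarith [hz.2, hy.2]⟩).trans_lt (by linarith)

theorem tendsto_primitive_left {f : ℝ → E}
    (h : ∀ u v, u ≤ v → HasKurzweilIntegral U u v (f v - f u)) (x : ℝ) :
    Tendsto (fun y => U x x - U x y - (f x - f y)) (𝓝[<] x) (𝓝 0) := by
  rw [Metric.tendsto_nhds]
  intro ε hε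
  obtain ⟨δ, hδ, hS⟩ := exists_gauge_norm_sub_le h (x - 1) x (half_pos hε)
  filter_upwards [Ioo_mem_nhdsLT (show x - min 1 (δ x) < x by linarith [lt_min one_pos (hδ x)])]
    with y hy
  have h1 := min_le_left 1 (δ x)
  have h2 := min_le_right 1 (δ x)
  rw [dist_zero_right]
  refine (hS y x x (by linarith [hy.1]) hy.2.le le_rfl le_rfl fun z hz =>
    ⟨by linarith [hz.1, hy.1], by linarith [hz.2, hδ x]⟩).trans_lt (by linarith)

theorem exists_primitive (h : ∀ u v, u ≤ v → ∃ J, HasKurzweilIntegral U u v J) (s : ℝ) :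
    ∃ f : ℝ → E, f s = 0 ∧ ∀ u v, u ≤ v → HasKurzweilIntegral U u v (f v - f u) := by
  choose! I hI using h
  have h0 : I s s = 0 := (hI s s le_rfl).unique (hasKurzweilIntegral_self U s) le_rfl
  refine ⟨fun t => if s ≤ t then I s t else - I t s, by simp [h0], fun u v huv => ?_⟩
  rcases le_or_gt s u with hu | hu
  · simp only [hu, hu.trans huv, if_true]
    exact (hI s u hu).sub_left (hI s v (hu.trans huv)) hu
  · rcases le_or_gt s v with hv | hv
    · simp only [hu.not_ge, hv, if_true, if_false]
      rw [sub_neg_eq_add, add_comm]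
      exact (hI u s hu.le).trans (hI s v hv) hu.le hv
    · simp only [hu.not_ge, hv.not_ge, if_false]
      rw [neg_sub_neg]
      exact (hI v s hv.le).sub_right (hI u s hu.le) hv.le

/-- The Cauchy criterion for integrability, in terms of approximate integrals. -/
theorem exists_hasKurzweilIntegral_of_approx [CompleteSpace E]
    (h : ∀ ε > 0, ∃ J : E, ∃ δ : ℝ → ℝ, (∀ x, 0 < δ x) ∧
      ∀ S, IsFineSum δ U a b S → ‖S - J‖ ≤ ε) (hab : a ≤ b) :
    ∃ J, HasKurzweilIntegral U a b J := by
  choose! J δ hδ hS using h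
  have key : ∀ ε > 0, ∀ η > 0, ‖J ε - J η‖ ≤ ε + η := by
    intro ε hε η hη
    obtain ⟨S, h1⟩ := exists_isFineSum U (δ := fun x => min (δ ε x) (δ η x))
      (fun x => lt_min (hδ ε hε x) (hδ η hη x)) hab
    have i1 := hS ε hε S (h1.mono fun x => min_le_left _ _)
    have i2 := hS η hη S (h1.mono fun x => min_le_right _ _)
    rw [show J ε - J η = (S - J η) - (S - J ε) by abel]
    linarith [norm_sub_le (S - J η) (S - J ε)]
  have hpos : ∀ n : ℕ, (0 : ℝ) < 1 / ((n : ℝ) + 1) := fun n => by positivity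
  -- The approximate integrals for `ε = 1/(n+1)` form a Cauchy sequence, whose limit is the
  -- integral.
  have hlim := tendsto_one_div_add_atTop_nhds_zero_nat (𝕜 := ℝ)
  have hc : CauchySeq fun n : ℕ => J (1 / ((n : ℝ) + 1)) := by
    refine cauchySeq_of_le_tendsto_0 (fun n : ℕ => 2 * (1 / ((n : ℝ) + 1))) ?_
      (by simpa using hlim.const_mul 2)
    intro n m N hn hm
    rw [dist_eq_norm]
    have i1 := key _ (hpos n) _ (hpos m)
    have i2 : 1 / ((n : ℝ) + 1) ≤ 1 / ((N : ℝ) + 1) := by gcongr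
    have i3 : 1 / ((m : ℝ) + 1) ≤ 1 / ((N : ℝ) + 1) := by gcongr
    linarith
  obtain ⟨L, hL⟩ := cauchySeq_tendsto_of_complete hc
  refine ⟨L, hasKurzweilIntegral_iff.2 fun ε hε => ?_⟩
  obtain ⟨n, hn1, hn2⟩ := ((hlim.eventually_lt_const (half_pos hε)).and
    ((Metric.tendsto_nhds.1 hL) _ (half_pos hε))).exists
  refine ⟨δ _, hδ _ (hpos n), fun S h1 => ?_⟩
  have i1 := hS _ (hpos n) S h1
  rw [dist_eq_norm] at hn2
  rw [show S - L = (S - J (1 / ((n : ℝ) + 1))) + (J (1 / ((n : ℝ) + 1)) - L) by abel]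
  linarith [norm_add_le (S - J (1 / ((n : ℝ) + 1))) (J (1 / ((n : ℝ) + 1)) - L)]

/-- If on each side of each point the increments of `U(τ, ·)` are those of a function independent of
the tag, up to errors small relative to a monotone function, then `U` is integrable. -/
theorem exists_hasKurzweilIntegral_of_local [CompleteSpace E] {h : ℝ → ℝ} (hh : Monotone h)
    (right : ∀ ε > 0, ∀ x, ∃ G : ℝ → E, (∃ L, Tendsto (fun y => U x y - G y) (𝓝[>] x) (𝓝 L)) ∧
      ∀ᶠ y in 𝓝[>] x, ∀ u τ v, x < u → u ≤ τ → τ ≤ v → v ≤ y →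
        ‖U τ v - U τ u - (G v - G u)‖ ≤ ε * h v - ε * h u)
    (left : ∀ ε > 0, ∀ x, ∃ G : ℝ → E, (∃ L, Tendsto (fun y => U x y - G y) (𝓝[<] x) (𝓝 L)) ∧
      ∀ᶠ y in 𝓝[<] x, ∀ u τ v, y ≤ u → u ≤ τ → τ ≤ v → v < x →
        ‖U τ v - U τ u - (G v - G u)‖ ≤ ε * h v - ε * h u)
    (hab : a ≤ b) : ∃ J, HasKurzweilIntegral U a b J := by
  -- The error bound is additive in the interval, as interval induction requires. The increment of
  -- `h` pays for the tags away from `x`; the length pays for replacing the increment next to `x` by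
  -- its limit.
  have main : ∀ ε > 0, ∃ J : E, ∃ δ : ℝ → ℝ, (∀ x, 0 < δ x) ∧
      ∀ S, IsFineSum δ U a b S → ‖S - J‖ ≤ ε * (h b + b - (h a + a)) := by
    intro ε hε
    refine interval_induction (Q := fun a b => ∃ J : E, ∃ δ : ℝ → ℝ, (∀ x, 0 < δ x) ∧
      ∀ S, IsFineSum δ U a b S → ‖S - J‖ ≤ ε * (h b + b - (h a + a))) ?_ ?_ ?_ ?_ hab
    · intro x
      exact ⟨0, fun _ => 1, fun _ => one_pos, fun S hS => by simp [hS.eq_zero rfl]⟩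
    · rintro a b c hab hbc ⟨J, δ, hδ, h1⟩ ⟨J', δ', hδ', h2⟩
      obtain ⟨η, hη, hη1, hη2, hη3⟩ := exists_gauge hδ hδ' b
      refine ⟨J + J', η, hη, fun S hS => ?_⟩
      obtain ⟨S₁, S₂, i1, i2, rfl⟩ := hS.split hη3 hab hbc
      have i1 := h1 _ (i1.mono hη1)
      have i2 := h2 _ (i2.mono hη2)
      rw [show S₁ + S₂ - (J + J') = (S₁ - J) + (S₂ - J') by abel]
      linarith [norm_add_le (S₁ - J) (S₂ - J')]
    · intro x
      obtain ⟨G, ⟨L, hL⟩, hG⟩ := right ε hε x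
      filter_upwards [hG, self_mem_nhdsWithin] with y hy hxy
      have hxy : x < y := hxy
      have hpos : 0 < ε * (y - x) := mul_pos hε (by linarith)
      obtain ⟨r, hr, hr'⟩ := (mem_nhdsGT_iff_exists_Ioo_subset).1
        (Metric.tendsto_nhds.1 hL _ hpos)
      have hr : x < r := hr
      obtain ⟨η, hη, hη1, -, hη3⟩ := exists_gauge (δ := fun _ => r - x) (δ' := fun _ => 1)
        (fun _ => by linarith) (fun _ => one_pos) x
      -- This is the limit as `t → x⁺` of `(U x t - U x x) + (G y - G t)`.
      refine ⟨L - U x x + G y, η, hη, fun S hS => ?_⟩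
      obtain ⟨t, S', ht1, ht2, hS', rfl⟩ := hS.first_interval hη3 hxy
      have i1 : dist (U x t - G t) L < ε * (y - x) := hr' ⟨ht1, by linarith [hη1 x]⟩
      have i2 := hS'.norm_sub_le (H := fun v => ε * h v) (G := G) fun u τ v g1 g2 g3 g4 =>
        hy u τ v (ht1.trans_le g1) g2 g3 g4
      have i3 : ε * h x ≤ ε * h t := mul_le_mul_of_nonneg_left (hh ht1.le) hε.le
      rw [dist_eq_norm] at i1
      rw [show U x t - U x x + S' - (L - U x x + G y)
        = (U x t - G t - L) + (S' - (G y - G t)) by abel]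
      have := norm_add_le (U x t - G t - L) (S' - (G y - G t))
      linarith
    · intro x
      obtain ⟨G, ⟨L, hL⟩, hG⟩ := left ε hε x
      filter_upwards [hG, self_mem_nhdsWithin] with y hy hxy
      have hxy : y < x := hxy
      have hpos : 0 < ε * (x - y) := mul_pos hε (by linarith)
      obtain ⟨r, hr, hr'⟩ := (mem_nhdsLT_iff_exists_Ioo_subset).1
        (Metric.tendsto_nhds.1 hL _ hpos)
      have hr : r < x := hr
      obtain ⟨η, hη, hη1, -, hη3⟩ := exists_gauge (δ := fun _ => x - r) (δ' := fun _ => 1)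
        (fun _ => by linarith) (fun _ => one_pos) x
      refine ⟨U x x - L - G y, η, hη, fun S hS => ?_⟩
      obtain ⟨t, S', ht1, ht2, hS', rfl⟩ := hS.last_interval hη3 hxy
      have i1 : dist (U x t - G t) L < ε * (x - y) := hr' ⟨by linarith [hη1 x], ht1⟩
      have i2 := hS'.norm_sub_le (H := fun v => ε * h v) (G := G) fun u τ v g1 g2 g3 g4 =>
        hy u τ v g1 g2 g3 (g4.trans_lt ht1)
      have i3 : ε * h t ≤ ε * h x := mul_le_mul_of_nonneg_left (hh ht1.le) hε.le
      rw [dist_eq_norm] at i1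
      rw [show S' + (U x x - U x t) - (U x x - L - G y)
        = (S' - (G t - G y)) - (U x t - G t - L) by abel]
      have := norm_sub_le (S' - (G t - G y)) (U x t - G t - L)
      linarith
  refine exists_hasKurzweilIntegral_of_approx (fun ε hε => ?_) hab
  have hC : 0 < h b + b - (h a + a) + 1 := by linarith [hh hab]
  obtain ⟨J, δ, hδ, hS⟩ := main (ε / (h b + b - (h a + a) + 1)) (by positivity)
  refine ⟨J, δ, hδ, fun S h1 => (hS S h1).trans ?_⟩
  rw [div_mul_eq_mul_div, div_le_iff₀ hC]
  nlinarith

end Integral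

/-! ### Regulated functions and functions dominated by a monotone one -/

section Regulated

variable {E : Type*} [NormedAddCommGroup E] {f g : ℝ → E} {h : ℝ → ℝ}

/-- `f` has one-sided limits everywhere. -/
def Regulated (f : ℝ → E) : Prop :=
  ∀ t, (∃ l, Tendsto f (𝓝[<] t) (𝓝 l)) ∧ ∃ l, Tendsto f (𝓝[>] t) (𝓝 l)

/-- The increments of `f` are bounded by those of `h`. -/
def DominatedBy (f : ℝ → E) (h : ℝ → ℝ) : Prop := ∀ a b, a ≤ b → ‖f b - f a‖ ≤ h b - h a

theorem DominatedBy.monotone (hf : DominatedBy f h) : Monotone h := fun a b hab => by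
  linarith [hf a b hab, norm_nonneg (f b - f a)]

theorem DominatedBy.norm_sub_le_abs (hf : DominatedBy f h) (a b : ℝ) :
    ‖f b - f a‖ ≤ |h b - h a| := by
  rcases le_total a b with hab | hab
  · exact (hf a b hab).trans (le_abs_self _)
  · rw [norm_sub_rev, abs_sub_comm]
    exact (hf b a hab).trans (le_abs_self _)

/-- The Cauchy property along the filter passes from `h` to `f`. -/
theorem DominatedBy.exists_tendsto [CompleteSpace E] (hf : DominatedBy f h) {l : Filter ℝ}
    [l.NeBot] {c : ℝ} (hl : Tendsto h l (𝓝 c)) : ∃ y, Tendsto f l (𝓝 y) := by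
  have h1 : Cauchy (map h l) := hl.cauchy_map
  refine cauchy_map_iff_exists_tendsto.1 ?_
  rw [cauchy_map_iff] at h1 ⊢
  refine ⟨h1.1, ?_⟩
  have h2 := tendsto_uniformity_iff_dist_tendsto_zero.1 h1.2
  refine tendsto_uniformity_iff_dist_tendsto_zero.2
    (squeeze_zero (fun _ => dist_nonneg) (fun p => ?_) h2)
  rw [dist_eq_norm, dist_eq_norm]
  exact hf.norm_sub_le_abs _ _

theorem DominatedBy.regulated [CompleteSpace E] (hf : DominatedBy f h) : Regulated f := fun t =>
  ⟨hf.exists_tendsto (hf.monotone.tendsto_nhdsLT t),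
    hf.exists_tendsto (hf.monotone.tendsto_nhdsGT t)⟩

theorem Regulated.sub (hf : Regulated f) (hg : Regulated g) : Regulated fun t => f t - g t := by
  intro t
  obtain ⟨⟨a, ha⟩, b, hb⟩ := hf t
  obtain ⟨⟨c, hc⟩, d, hd⟩ := hg t
  exact ⟨⟨_, ha.sub hc⟩, _, hb.sub hd⟩

theorem Regulated.add (hf : Regulated f) (hg : Regulated g) : Regulated fun t => f t + g t := by
  intro t
  obtain ⟨⟨a, ha⟩, b, hb⟩ := hf t
  obtain ⟨⟨c, hc⟩, d, hd⟩ := hg t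
  exact ⟨⟨_, ha.add hc⟩, _, hb.add hd⟩

theorem regulated_const (c : E) : Regulated fun _ : ℝ => c := fun _ =>
  ⟨⟨c, tendsto_const_nhds⟩, c, tendsto_const_nhds⟩

theorem Regulated.regulatedFrom (hf : Regulated f) (s : ℝ) : RegulatedFrom s f :=
  ⟨fun t _ => (hf t).1, fun t _ => (hf t).2⟩

/-- Freezing the function at its value at `s` to the left of `s` moves the problem to the whole line
without changing integrals over `[s, ∞)`. -/
theorem RegulatedFrom.regulated {s : ℝ} (hf : RegulatedFrom s f) :
    Regulated fun t => f (max s t) := by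
  intro t
  constructor
  · rcases le_or_gt t s with h | h
    · refine ⟨f s, tendsto_const_nhds.congr' ?_⟩
      filter_upwards [self_mem_nhdsWithin] with y hy
      rw [max_eq_left ((mem_Iio.1 hy).le.trans h)]
    · obtain ⟨l, hl⟩ := hf.1 t h
      refine ⟨l, hl.congr' ?_⟩
      filter_upwards [Ioo_mem_nhdsLT h] with y hy
      rw [max_eq_right hy.1.le]
  · rcases le_or_gt s t with h | h
    · obtain ⟨l, hl⟩ := hf.2 t h
      refine ⟨l, hl.congr' ?_⟩
      filter_upwards [self_mem_nhdsWithin] with y hy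
      rw [max_eq_right (h.trans (mem_Ioi.1 hy).le)]
    · refine ⟨f s, tendsto_const_nhds.congr' ?_⟩
      filter_upwards [Ioo_mem_nhdsGT h] with y hy
      rw [max_eq_left hy.2.le]

theorem RegulatedFrom.congr {s : ℝ} (hf : RegulatedFrom s f) (h : ∀ t, s ≤ t → f t = g t) :
    RegulatedFrom s g := by
  refine ⟨fun t ht => ?_, fun t ht => ?_⟩
  · obtain ⟨l, hl⟩ := hf.1 t ht
    refine ⟨l, hl.congr' ?_⟩
    filter_upwards [Ioo_mem_nhdsLT ht] with y hy using h y hy.1.le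
  · obtain ⟨l, hl⟩ := hf.2 t ht
    refine ⟨l, hl.congr' ?_⟩
    filter_upwards [self_mem_nhdsWithin] with y hy using h y (ht.trans (mem_Ioi.1 hy).le)

theorem regulated_primitive {U : ℝ → ℝ → E} (hU : ∀ τ, Regulated (U τ))
    (hg : ∀ u v, u ≤ v → HasKurzweilIntegral U u v (g v - g u)) : Regulated g := by
  intro t
  obtain ⟨⟨a, ha⟩, b, hb⟩ := hU t t
  refine ⟨⟨_, ((((tendsto_primitive_left hg t).add_const (g t)).sub_const (U t t)).add ha).congr
    fun y => ?_⟩, _, (((hb.sub_const (U t t)).sub (tendsto_primitive_right hg t)).add_const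
    (g t)).congr fun y => ?_⟩ <;> abel

end Regulated

/-! ### Existence of the nonlinear and Stieltjes integrals -/

section Existence

variable {Z : Type*} [NormedAddCommGroup Z]
  {F : Z → ℝ → Z} {h : ℝ → ℝ} {a b : ℝ} {f : ℝ → Z}

theorem ClassF.dominatedBy (hF : ClassF F h) (z : Z) : DominatedBy (F z) h := fun a b hab =>
  (hF.bound z a b).trans_eq (abs_of_nonneg (sub_nonneg.2 (hF.mono hab)))

theorem ClassF.lipschitz_of_le (hF : ClassF F h) (z w : Z) {u v ε : ℝ} (huv : u ≤ v)
    (hzw : ‖z - w‖ ≤ ε) : ‖F z v - F z u - (F w v - F w u)‖ ≤ ε * h v - ε * h u := by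
  have := hF.lipschitz z w u v
  rw [abs_of_nonneg (sub_nonneg.2 (hF.mono huv))] at this
  rw [sub_sub_eq_add_sub, add_comm, ← add_sub_assoc, add_comm, ← mul_sub] at *
  refine le_trans (le_of_eq ?_) (this.trans
    (mul_le_mul_of_nonneg_right hzw (sub_nonneg.2 (hF.mono huv))))
  congr 1; abel

/-- On one side of `x`, `z` is close to its one-sided limit `l`, so the Lipschitz condition lets `F
l` serve as the tag-independent comparison function. -/
theorem ClassF.exists_hasKurzweilIntegral [CompleteSpace Z] (hF : ClassF F h) {z : ℝ → Z}
    (hz : Regulated z) (hab : a ≤ b) :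
    ∃ J, HasKurzweilIntegral (fun τ γ => F (z τ) γ) a b J := by
  refine exists_hasKurzweilIntegral_of_local hF.mono (fun ε hε x => ?_) (fun ε hε x => ?_) hab
  · obtain ⟨l, hl⟩ := (hz x).2
    obtain ⟨p, hp⟩ := ((hF.dominatedBy (z x)).regulated x).2
    obtain ⟨q, hq⟩ := ((hF.dominatedBy l).regulated x).2
    refine ⟨F l, ⟨_, hp.sub hq⟩, ?_⟩
    obtain ⟨r, hr, hr'⟩ := (mem_nhdsGT_iff_exists_Ioo_subset).1 (Metric.tendsto_nhds.1 hl _ hε)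
    filter_upwards [Ioo_mem_nhdsGT hr] with y hy u τ v h1 h2 h3 h4
    have := hr' ⟨h1.trans_le h2, (h3.trans h4).trans_lt hy.2⟩
    exact hF.lipschitz_of_le _ _ (h2.trans h3) (by rw [← dist_eq_norm]; exact le_of_lt this)
  · obtain ⟨l, hl⟩ := (hz x).1
    obtain ⟨p, hp⟩ := ((hF.dominatedBy (z x)).regulated x).1
    obtain ⟨q, hq⟩ := ((hF.dominatedBy l).regulated x).1
    refine ⟨F l, ⟨_, hp.sub hq⟩, ?_⟩
    obtain ⟨r, hr, hr'⟩ := (mem_nhdsLT_iff_exists_Ioo_subset).1 (Metric.tendsto_nhds.1 hl _ hε)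
    filter_upwards [Ioo_mem_nhdsLT hr] with y hy u τ v h1 h2 h3 h4
    have := hr' ⟨hy.1.trans_le (h1.trans h2), h3.trans_lt h4⟩
    exact hF.lipschitz_of_le _ _ (h2.trans h3) (by rw [← dist_eq_norm]; exact le_of_lt this)

variable [NormedSpace ℝ Z] {A B : ℝ → Z →L[ℝ] Z}

theorem tendsto_clm_apply {l : Filter ℝ} {T : Z →L[ℝ] Z} {x : Z} (hA : Tendsto A l (𝓝 T))
    (hf : Tendsto f l (𝓝 x)) : Tendsto (fun t => A t (f t)) l (𝓝 (T x)) :=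
  (isBoundedBilinearMap_apply.continuous.tendsto (T, x)).comp (hA.prodMk_nhds hf)

theorem Regulated.mul (hA : Regulated A) (hB : Regulated B) : Regulated fun t => A t * B t := by
  intro t
  obtain ⟨⟨a, ha⟩, b, hb⟩ := hA t
  obtain ⟨⟨c, hc⟩, d, hd⟩ := hB t
  exact ⟨⟨_, ha.mul hc⟩, _, hb.mul hd⟩

theorem Regulated.clm_apply (hA : Regulated A) (hf : Regulated f) :
    Regulated fun t => A t (f t) := by
  intro t
  obtain ⟨⟨a, ha⟩, b, hb⟩ := hA t
  obtain ⟨⟨c, hc⟩, d, hd⟩ := hf t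
  exact ⟨⟨_, tendsto_clm_apply ha hc⟩, _, tendsto_clm_apply hb hd⟩

/-- Summation by parts on a single interval. -/
theorem norm_stieltjes_sub_le {u τ v C : ℝ} (hu : ‖A u‖ ≤ C) (hv : ‖A v‖ ≤ C)
    (h1 : ‖f τ - f u‖ ≤ h τ - h u) (h2 : ‖f v - f τ‖ ≤ h v - h τ) :
    ‖A v (f τ) - A u (f τ) - (A v (f v) - A u (f u))‖ ≤ C * h v - C * h u := by
  have e : A v (f τ) - A u (f τ) - (A v (f v) - A u (f u))
      = -(A v (f v - f τ)) - A u (f τ - f u) := by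
    simp only [map_sub]; abel
  have hC : 0 ≤ C := (norm_nonneg _).trans hu
  have i1 := (A v).le_of_opNorm_le_of_le hv h2
  have i2 := (A u).le_of_opNorm_le_of_le hu h1
  have := norm_sub_le (-(A v (f v - f τ))) (A u (f τ - f u))
  rw [norm_neg] at this
  rw [e]
  linarith

/-- Only the supremum of `A` and the variation of `f` matter; this is what makes the contraction
estimate independent of the variation of the kernels. -/
theorem norm_stieltjes_le {C : ℝ} {J : Z} (hJ : HasKurzweilIntegral (fun τ γ => A γ (f τ)) a b J)
    (hab : a ≤ b) (hA : ∀ γ, a ≤ γ → γ ≤ b → ‖A γ‖ ≤ C)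
    (hf : ∀ u v, a ≤ u → u ≤ v → v ≤ b → ‖f v - f u‖ ≤ h v - h u) :
    ‖J - (A b (f b) - A a (f a))‖ ≤ C * h b - C * h a :=
  hJ.norm_sub_le (H := fun v => C * h v) (G := fun v => A v (f v)) hab
    fun u τ v h1 h2 h3 h4 => norm_stieltjes_sub_le (hA u h1 (by linarith))
      (hA v (by linarith) h4) (hf u τ h1 h2 (by linarith)) (hf τ v (by linarith) h3 h4)

theorem exists_hasKurzweilIntegral_stieltjes [CompleteSpace Z] (hA : Regulated A)
    (hf : DominatedBy f h) (hab : a ≤ b) :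
    ∃ J, HasKurzweilIntegral (fun τ γ => A γ (f τ)) a b J := by
  -- Subtracting the one-sided limit `l` leaves the increments of `A` unchanged and makes the
  -- integrator small near `x`. Summation by parts then replaces the increments by those of `(A - l)
  -- f`, with error at most `ε` times the increment of `h`.
  have key : ∀ (l : Z →L[ℝ] Z) u τ v ε, u ≤ τ → τ ≤ v → dist (A u) l < ε → dist (A v) l < ε →
      ‖A v (f τ) - A u (f τ) - ((A v - l) (f v) - (A u - l) (f u))‖ ≤ ε * h v - ε * h u := by
    intro l u τ v ε h1 h2 h3 h4
    rw [dist_eq_norm] at h3 h4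
    refine le_trans (le_of_eq ?_) (norm_stieltjes_sub_le (A := fun t => A t - l) h3.le h4.le
      (hf u τ h1) (hf τ v h2))
    congr 1
    simp
  refine exists_hasKurzweilIntegral_of_local hf.monotone (fun ε hε x => ?_) (fun ε hε x => ?_) hab
  · obtain ⟨l, hl⟩ := (hA x).2
    obtain ⟨p, hp⟩ := (hf.regulated x).2
    refine ⟨fun t => (A t - l) (f t), ⟨_, (tendsto_clm_apply hl tendsto_const_nhds).sub
      (tendsto_clm_apply (hl.sub_const l) hp)⟩, ?_⟩
    obtain ⟨r, hr, hr'⟩ := (mem_nhdsGT_iff_exists_Ioo_subset).1 (Metric.tendsto_nhds.1 hl _ hε)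
    filter_upwards [Ioo_mem_nhdsGT hr] with y hy u τ v h1 h2 h3 h4
    exact key l u τ v ε h2 h3 (hr' ⟨h1, by linarith [hy.2]⟩) (hr' ⟨by linarith, by linarith [hy.2]⟩)
  · obtain ⟨l, hl⟩ := (hA x).1
    obtain ⟨p, hp⟩ := (hf.regulated x).1
    refine ⟨fun t => (A t - l) (f t), ⟨_, (tendsto_clm_apply hl tendsto_const_nhds).sub
      (tendsto_clm_apply (hl.sub_const l) hp)⟩, ?_⟩
    obtain ⟨r, hr, hr'⟩ := (mem_nhdsLT_iff_exists_Ioo_subset).1 (Metric.tendsto_nhds.1 hl _ hε)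
    filter_upwards [Ioo_mem_nhdsLT hr] with y hy u τ v h1 h2 h3 h4
    exact key l u τ v ε h2 h3 (hr' ⟨by linarith [hy.1], by linarith⟩) (hr' ⟨by linarith [hy.1], h4⟩)

theorem exists_primitive_stieltjes [CompleteSpace Z] (hA : Regulated A)
    (hf : DominatedBy f h) (s : ℝ) : ∃ g : ℝ → Z, Regulated g ∧ g s = 0 ∧
      ∀ u v, u ≤ v → HasKurzweilIntegral (fun τ γ => A γ (f τ)) u v (g v - g u) := by
  obtain ⟨g, hg, hg'⟩ := exists_primitive
    (fun _ _ huv => exists_hasKurzweilIntegral_stieltjes hA hf huv) s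
  exact ⟨g, regulated_primitive (fun τ => hA.clm_apply (regulated_const (f τ))) hg', hg, hg'⟩

end Existence

/-! ### From bounds on the variation to dominating monotone functions -/

section Variation

variable {E : Type*} [NormedAddCommGroup E] {g : ℝ → E}

theorem locallyBoundedVariationOn_of_unitVariation (hg : unitVariation g ≠ ⊤) :
    LocallyBoundedVariationOn g univ := by
  have unit : ∀ c d, c < d → d - c ≤ 1 → eVariationOn g (Icc c d) ≠ ⊤ := fun c d h1 h2 =>
    ne_top_of_le_ne_top hg (le_iSup₂_of_le c d (le_iSup₂_of_le h1 h2 le_rfl))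
  have key : ∀ a b, a ≤ b → eVariationOn g (Icc a b) ≠ ⊤ := by
    intro a b hab
    refine interval_induction (Q := fun a b => eVariationOn g (Icc a b) ≠ ⊤) (fun x => ?_)
      (fun a b c hab hbc h1 h2 => ?_) (fun x => ?_) (fun x => ?_) hab
    · rw [eVariationOn.subsingleton g (by simp)]
      exact ENNReal.zero_ne_top
    · have := eVariationOn.Icc_add_Icc g hab hbc (mem_univ b)
      simp only [univ_inter] at this
      rw [← this]
      exact ENNReal.add_ne_top.2 ⟨h1, h2⟩
    · filter_upwards [Ioo_mem_nhdsGT (lt_add_one x)] with y hy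
      exact unit x y hy.1 (by linarith [hy.2])
    · filter_upwards [Ioo_mem_nhdsLT (sub_one_lt x)] with y hy
      exact unit y x hy.2 (by linarith [hy.1])
  intro a b _ _
  rw [univ_inter]
  rcases le_or_gt a b with hab | hab
  · exact key a b hab
  · rw [Icc_eq_empty (not_le.2 hab)]
    exact BoundedVariationOn.of_subsingleton subsingleton_empty

theorem exists_dominatedBy_of_locallyBoundedVariationOn (hg : LocallyBoundedVariationOn g univ) :
    ∃ l : ℝ → ℝ, DominatedBy g l := by
  refine ⟨variationOnFromTo g univ 0, fun a b hab => ?_⟩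
  rw [variationOnFromTo.sub_right hg (mem_univ _) (mem_univ _) (mem_univ _),
    variationOnFromTo.eq_of_le _ _ hab, ← dist_eq_norm]
  exact (hg a b (mem_univ _) (mem_univ _)).dist_le ⟨mem_univ _, hab, le_rfl⟩
    ⟨mem_univ _, le_rfl, hab⟩

theorem sub_le_of_totalVariation_lt {h : ℝ → ℝ} {ε : ℝ}
    (hv : totalVariation h < ENNReal.ofReal ε) {a b : ℝ} (hab : a ≤ b) : h b - h a ≤ ε := by
  have hε : 0 < ε := ENNReal.ofReal_pos.1 (bot_lt_of_lt hv)
  rcases hab.lt_or_eq with hab | rfl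
  · have h1 : edist (h b) (h a) ≤ totalVariation h :=
      (eVariationOn.edist_le h (s := Icc a b) ⟨hab.le, le_rfl⟩ ⟨le_rfl, hab.le⟩).trans
        (le_iSup₂_of_le (f := fun c d => ⨆ _ : c < d, eVariationOn h (Icc c d)) a b
          (le_iSup_of_le hab le_rfl))
    rw [edist_dist] at h1
    have h2 := (ENNReal.ofReal_lt_ofReal_iff hε).1 (h1.trans_lt hv)
    rw [Real.dist_eq] at h2
    exact (le_abs_self _).trans h2.le
  · simpa using hε.le

end Variation

theorem eventually_nhds_of_sides {p : ℝ → Prop} {x : ℝ} (hl : ∀ᶠ t in 𝓝[<] x, p t) (hx : p x)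
    (hr : ∀ᶠ t in 𝓝[>] x, p t) : ∀ᶠ t in 𝓝 x, p t := by
  obtain ⟨l, hlx, hl⟩ := (mem_nhdsLT_iff_exists_Ioo_subset).1 hl
  obtain ⟨r, hrx, hr⟩ := (mem_nhdsGT_iff_exists_Ioo_subset).1 hr
  filter_upwards [Ioo_mem_nhds hlx hrx] with t ht
  rcases lt_trichotomy t x with h | rfl | h
  · exact hl ⟨ht.1, h⟩
  · exact hx
  · exact hr ⟨h, ht.2⟩

/-! ### The linear equation: jumps, uniqueness and the cocycle law -/

section Linear

variable {Z : Type*} [NormedAddCommGroup Z] [NormedSpace ℝ Z]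
  {Λ : ℝ → Z →L[ℝ] Z} {l : ℝ → ℝ} {Y : ℝ → Z →L[ℝ] Z} {V : ℝ → ℝ → Z →L[ℝ] Z}

/-- `Y` solves the operator equation `dY/dτ = D[Λ(t) Y]` on `ℝ`. -/
def IsLinearSolution (Λ Y : ℝ → Z →L[ℝ] Z) : Prop :=
  ∀ a b, a ≤ b → HasKurzweilIntegral (fun τ γ => Λ γ * Y τ) a b (Y b - Y a)

/-- The jump of the primitive `Y` at `x` is that of `Λ · Y x`; hence the operators in (H1) carry `Y
x` to its one-sided limits. -/
theorem IsLinearSolution.tendsto_right (hY : IsLinearSolution Λ Y) (hΛ : Regulated Λ) (x : ℝ) :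
    Tendsto Y (𝓝[>] x) (𝓝 ((1 + (Function.rightLim Λ x - Λ x)) * Y x)) := by
  have h1 := tendsto_primitive_right hY x
  have h2 := (tendsto_rightLim_of_tendsto (hΛ x).2).mul_const (Y x)
  have h3 := ((h2.sub_const (Λ x * Y x)).sub h1).add_const (Y x)
  refine (h3.congr fun y => by abel).trans (le_of_eq ?_)
  congr 1
  simp only [add_mul, sub_mul, one_mul]
  abel

theorem IsLinearSolution.tendsto_left (hY : IsLinearSolution Λ Y) (hΛ : Regulated Λ) (x : ℝ) :
    Tendsto Y (𝓝[<] x) (𝓝 ((1 - (Λ x - Function.leftLim Λ x)) * Y x)) := by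
  have h1 := tendsto_primitive_left hY x
  have h2 := (tendsto_leftLim_of_tendsto (hΛ x).1).mul_const (Y x)
  have h3 := ((h2.sub_const (Λ x * Y x)).add h1).add_const (Y x)
  refine (h3.congr fun y => by abel).trans (le_of_eq ?_)
  congr 1
  simp only [sub_mul, one_mul]
  abel

theorem IsLinearSolution.norm_sub_le (hY : IsLinearSolution Λ Y) (hΛ : DominatedBy Λ l)
    {a b M : ℝ} (hab : a ≤ b) (hM : ∀ t, a ≤ t → t ≤ b → ‖Y t‖ ≤ M) :
    ‖Y b - Y a‖ ≤ M * (l b - l a) := by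
  have := (hY a b hab).norm_sub_le (H := fun v => M * l v) (G := fun _ => 0) hab
    fun u τ v h1 h2 h3 h4 => by
      rw [sub_zero, sub_zero, ← sub_mul, ← mul_sub, mul_comm M]
      exact (norm_mul_le _ _).trans (mul_le_mul (hΛ u v (h2.trans h3))
        (hM τ (h1.trans h2) (h3.trans h4)) (norm_nonneg _)
        (sub_nonneg.2 (hΛ.monotone (h2.trans h3))))
  simpa [mul_sub] using this

theorem eq_zero_of_forall_halving {s : Set ℝ} (h0 : ∀ t ∈ s, ‖Y t‖ ≤ 1)
    (h : ∀ M, (∀ t ∈ s, ‖Y t‖ ≤ M) → ∀ t ∈ s, ‖Y t‖ ≤ M * (1 / 2)) {t : ℝ} (ht : t ∈ s) :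
    Y t = 0 := by
  have key : ∀ n : ℕ, ∀ t ∈ s, ‖Y t‖ ≤ (1 / 2) ^ n := by
    intro n
    induction n with
    | zero => simpa using h0
    | succ n ih => simpa only [pow_succ] using h _ ih
  exact norm_le_zero_iff.1 (ge_of_tendsto'
    (tendsto_pow_atTop_nhds_zero_of_lt_one (by norm_num) (by norm_num)) fun n => key n t ht)

/-- `Y` tends to zero at `x⁺`, so `Y t` is the limit of `Y t - Y s` as `s → x⁺`. Where `l` increases
by at most `1/2`, any bound on `Y` is thereby halved. -/
theorem IsLinearSolution.eventually_right (hY : IsLinearSolution Λ Y) [CompleteSpace Z]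
    (hΛ : DominatedBy Λ l) {x : ℝ} (hx : Y x = 0) : ∀ᶠ t in 𝓝[>] x, Y t = 0 := by
  have h1 := hY.tendsto_right hΛ.regulated x
  rw [hx, mul_zero] at h1
  have h2 := hΛ.monotone.tendsto_nhdsGT x
  obtain ⟨u, hu, hu'⟩ := (mem_nhdsGT_iff_exists_Ioo_subset).1
    -- Values of `l` within `1/4` of its right limit differ by at most `1/2`; the bound `1` on `Y`
    -- starts the halving.
    ((Metric.tendsto_nhds.1 h1 1 one_pos).and (Metric.tendsto_nhds.1 h2 (1 / 4) (by norm_num)))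
  filter_upwards [Ioo_mem_nhdsGT hu] with t ht
  refine eq_zero_of_forall_halving (s := Ioo x u) (fun t ht => ?_) (fun M hM t ht => ?_) ht
  · simpa using (hu' ht).1.le
  · have h3 : Tendsto (fun s => ‖Y t - Y s‖) (𝓝[>] x) (𝓝 ‖Y t‖) := by
      simpa only [sub_zero] using ((tendsto_const_nhds (x := Y t)).sub h1).norm
    refine le_of_tendsto h3 ?_
    filter_upwards [Ioo_mem_nhdsGT ht.1] with s hs
    refine (hY.norm_sub_le hΛ hs.2.le fun r h1 h2 =>
      hM r ⟨hs.1.trans_le h1, h2.trans_lt ht.2⟩).trans ?_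
    have i1 := (hu' ht).2
    have i2 := (hu' ⟨hs.1, hs.2.trans ht.2⟩).2
    rw [Real.dist_eq, abs_lt] at i1 i2
    exact mul_le_mul_of_nonneg_left (by linarith) ((norm_nonneg _).trans (hM t ht))

theorem IsLinearSolution.eventually_left (hY : IsLinearSolution Λ Y) [CompleteSpace Z]
    (hΛ : DominatedBy Λ l) {x : ℝ} (hx : Y x = 0) : ∀ᶠ t in 𝓝[<] x, Y t = 0 := by
  have h1 := hY.tendsto_left hΛ.regulated x
  rw [hx, mul_zero] at h1
  have h2 := hΛ.monotone.tendsto_nhdsLT x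
  obtain ⟨u, hu, hu'⟩ := (mem_nhdsLT_iff_exists_Ioo_subset).1
    ((Metric.tendsto_nhds.1 h1 1 one_pos).and (Metric.tendsto_nhds.1 h2 (1 / 4) (by norm_num)))
  filter_upwards [Ioo_mem_nhdsLT hu] with t ht
  refine eq_zero_of_forall_halving (s := Ioo u x) (fun t ht => ?_) (fun M hM t ht => ?_) ht
  · simpa using (hu' ht).1.le
  · have h3 : Tendsto (fun s => ‖Y t - Y s‖) (𝓝[<] x) (𝓝 ‖Y t‖) := by
      simpa only [sub_zero] using ((tendsto_const_nhds (x := Y t)).sub h1).norm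
    refine le_of_tendsto h3 ?_
    filter_upwards [Ioo_mem_nhdsLT ht.2] with s hs
    rw [norm_sub_rev]
    refine (hY.norm_sub_le hΛ hs.1.le fun r h1 h2 =>
      hM r ⟨ht.1.trans_le h1, h2.trans_lt hs.2⟩).trans ?_
    have i1 := (hu' ht).2
    have i2 := (hu' ⟨ht.1.trans hs.1, hs.2⟩).2
    rw [Real.dist_eq, abs_lt] at i1 i2
    exact mul_le_mul_of_nonneg_left (by linarith) ((norm_nonneg _).trans (hM t ht))

variable {Ca : ℝ} {VΛ : ℝ≥0}

theorem LinearHyp.exists_dominatedBy (hΛ : LinearHyp Λ Ca VΛ) : ∃ l : ℝ → ℝ, DominatedBy Λ l :=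
  exists_dominatedBy_of_locallyBoundedVariationOn (locallyBoundedVariationOn_of_unitVariation
    (ne_top_of_le_ne_top ENNReal.coe_ne_top hΛ.variation))

theorem LinearHyp.regulated [CompleteSpace Z] (hΛ : LinearHyp Λ Ca VΛ) : Regulated Λ :=
  hΛ.exists_dominatedBy.choose_spec.regulated

/-- A solution of the linear equation vanishing at one point vanishes identically. -/
theorem IsLinearSolution.eq_zero [CompleteSpace Z] (hY : IsLinearSolution Λ Y)
    (hΛ : LinearHyp Λ Ca VΛ) {r : ℝ} (hr : Y r = 0) (t : ℝ) : Y t = 0 := by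
  obtain ⟨l, hl⟩ := hΛ.exists_dominatedBy
  -- Closed: if `Y x ≠ 0`, invertibility of the jump operators makes both one-sided limits nonzero.
  -- Open: the halving argument on each side.
  have hclopen : IsClopen {t | Y t = 0} := by
    refine ⟨⟨isOpen_iff_mem_nhds.2 fun x hx => ?_⟩, isOpen_iff_mem_nhds.2 fun x hx => ?_⟩
    · refine eventually_nhds_of_sides (p := fun t => Y t ≠ 0) ?_ hx ?_
      · exact (hY.tendsto_left hl.regulated x).eventually_ne
          fun h => hx ((hΛ.left_isUnit x).mul_right_eq_zero.1 h)
      · exact (hY.tendsto_right hl.regulated x).eventually_ne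
          fun h => hx ((hΛ.right_isUnit x).mul_right_eq_zero.1 h)
    · exact eventually_nhds_of_sides (p := fun t => Y t = 0) (hY.eventually_left hl hx) hx
        (hY.eventually_right hl hx)
  exact eq_univ_iff_forall.1 (hclopen.eq_univ ⟨r, hr⟩) t

theorem IsFundamentalOperator.self (hV : IsFundamentalOperator Λ V) (s : ℝ) : V s s = 1 :=
  sub_eq_zero.1 (((hV.integral_eq s s).1 le_rfl).unique (hasKurzweilIntegral_self _ s) le_rfl)

theorem IsFundamentalOperator.isLinearSolution (hV : IsFundamentalOperator Λ V) (s : ℝ) :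
    IsLinearSolution Λ fun t => V t s := by
  intro a b hab
  rcases le_total s a with h | h
  · simpa using ((hV.integral_eq a s).1 h).sub_left ((hV.integral_eq b s).1 (h.trans hab)) h
  · rcases le_total s b with h' | h'
    · simpa using ((hV.integral_eq a s).2 h).trans ((hV.integral_eq b s).1 h') h h'
    · simpa using ((hV.integral_eq b s).2 h').sub_right ((hV.integral_eq a s).2 h) h'

theorem IsLinearSolution.mul_const (hY : IsLinearSolution Λ Y) (W : Z →L[ℝ] Z) :
    IsLinearSolution Λ fun t => Y t * W := by
  intro a b hab
  have := (hY a b hab).map_clm ((ContinuousLinearMap.mul ℝ (Z →L[ℝ] Z)).flip W)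
  simpa [sub_mul, mul_assoc] using this

theorem IsLinearSolution.sub {X : ℝ → Z →L[ℝ] Z} (hY : IsLinearSolution Λ Y)
    (hX : IsLinearSolution Λ X) : IsLinearSolution Λ fun t => Y t - X t := by
  intro a b hab
  convert (hY a b hab).sub (hX a b hab) using 1
  · simp only [mul_sub]
  · exact sub_sub_sub_comm _ _ _ _

variable [CompleteSpace Z]

/-- As functions of `t` both sides solve the linear equation and they agree at `t = r`. -/
theorem IsFundamentalOperator.cocycle (hV : IsFundamentalOperator Λ V) (hΛ : LinearHyp Λ Ca VΛ)
    (t r s : ℝ) : V t r * V r s = V t s :=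
  sub_eq_zero.1 ((((hV.isLinearSolution r).mul_const (V r s)).sub
    (hV.isLinearSolution s)).eq_zero hΛ (r := r) (by simp [hV.self]) t)

theorem IsFundamentalOperator.mul_swap (hV : IsFundamentalOperator Λ V) (hΛ : LinearHyp Λ Ca VΛ)
    (t s : ℝ) : V t s * V s t = 1 := by rw [hV.cocycle hΛ, hV.self]

theorem IsFundamentalOperator.isUnit (hV : IsFundamentalOperator Λ V) (hΛ : LinearHyp Λ Ca VΛ)
    (t s : ℝ) : IsUnit (V t s) :=
  ⟨⟨V t s, V s t, hV.mul_swap hΛ t s, hV.mul_swap hΛ s t⟩, rfl⟩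

theorem IsFundamentalOperator.inverse_eq (hV : IsFundamentalOperator Λ V)
    (hΛ : LinearHyp Λ Ca VΛ) (t s : ℝ) : Ring.inverse (V t s) = V s t :=
  Ring.inverse_unit (⟨V t s, V s t, hV.mul_swap hΛ t s, hV.mul_swap hΛ s t⟩ : (Z →L[ℝ] Z)ˣ)

theorem IsFundamentalOperator.regulated (hV : IsFundamentalOperator Λ V)
    (hΛ : LinearHyp Λ Ca VΛ) (s : ℝ) : Regulated fun t => V t s := fun t =>
  ⟨⟨_, (hV.isLinearSolution s).tendsto_left hΛ.regulated t⟩,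
    _, (hV.isLinearSolution s).tendsto_right hΛ.regulated t⟩

/-- `V(s,t)` is the inverse of `V(t,s)`, whose one-sided limits in `t` are jump operators times
`V(t,s)`, hence invertible; inversion is continuous there. -/
theorem IsFundamentalOperator.regulated_snd (hV : IsFundamentalOperator Λ V)
    (hΛ : LinearHyp Λ Ca VΛ) (s : ℝ) : Regulated fun t => V s t := by
  have key : ∀ {f : Filter ℝ} {T : Z →L[ℝ] Z}, IsUnit T → Tendsto (fun t => V t s) f (𝓝 T) →
      ∃ L, Tendsto (fun t => V s t) f (𝓝 L) := by
    rintro f _ ⟨u, rfl⟩ h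
    exact ⟨_, ((NormedRing.inverse_continuousAt u).tendsto.comp h).congr
      fun t => hV.inverse_eq hΛ t s⟩
  exact fun t => ⟨key ((hΛ.left_isUnit t).mul (hV.isUnit hΛ t s))
    ((hV.isLinearSolution s).tendsto_left hΛ.regulated t),
    key ((hΛ.right_isUnit t).mul (hV.isUnit hΛ t s))
    ((hV.isLinearSolution s).tendsto_right hΛ.regulated t)⟩

variable {P : ℝ → Z →L[ℝ] Z} {K α : ℝ}

theorem IsExpDichotomy.regulated (hP : IsExpDichotomy V P K α) (hV : IsFundamentalOperator Λ V)
    (hΛ : LinearHyp Λ Ca VΛ) : Regulated P := by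
  -- Invariance makes all projections conjugate to `P 0`, so `P` inherits its one-sided limits from
  -- `V`.
  have h : P = fun t => V t 0 * P 0 * V 0 t := by
    ext1 t
    rw [← hP.invariant t 0, mul_assoc, hV.mul_swap hΛ, mul_one]
  rw [h]
  exact ((hV.regulated hΛ 0).mul (regulated_const (P 0))).mul (hV.regulated_snd hΛ 0)

end Linear

theorem hasKurzweilIntegral_zero {E : Type*} [NormedAddCommGroup E] {U : ℝ → ℝ → E}
    (hU : ∀ τ γ, U τ γ = 0) (a b : ℝ) : HasKurzweilIntegral U a b 0 := by
  rw [hasKurzweilIntegral_iff]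
  intro ε hε
  refine ⟨fun _ => 1, fun _ => one_pos, fun S hS => ?_⟩
  have := hS.norm_sub_le (H := fun _ => 0) (G := fun _ => 0) fun u τ v _ _ _ _ => by simp [hU]
  simp only [sub_zero] at this ⊢
  linarith

theorem HasImproperKurzweilIntegral.unique {E : Type*} [NormedAddCommGroup E] {U : ℝ → ℝ → E}
    {c : ℝ} {I J : E} (h : HasImproperKurzweilIntegral U c I)
    (h' : HasImproperKurzweilIntegral U c J) : I = J := by
  obtain ⟨g, hg, hI⟩ := h
  obtain ⟨g', hg', hJ⟩ := h'
  refine tendsto_nhds_unique (hI.congr' ?_) hJ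
  filter_upwards [eventually_ge_atTop c] with T hT using (hg T hT).unique (hg' T hT) hT

theorem exists_tendsto_of_approx {E : Type*} [NormedAddCommGroup E] [CompleteSpace E]
    {l : Filter ℝ} [l.NeBot] {f : ℝ → E}
    (h : ∀ ε > 0, ∃ g : ℝ → E, (∃ y, Tendsto g l (𝓝 y)) ∧ ∀ᶠ t in l, dist (f t) (g t) ≤ ε) :
    ∃ y, Tendsto f l (𝓝 y) := by
  refine cauchy_map_iff_exists_tendsto.1 (Metric.cauchy_iff.2 ⟨inferInstance, fun ε hε => ?_⟩)
  obtain ⟨g, ⟨y, hy⟩, hg⟩ := h (ε / 4) (by linarith)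
  refine ⟨_, image_mem_map (hg.and (Metric.tendsto_nhds.1 hy (ε / 4) (by linarith))), ?_⟩
  rintro _ ⟨a, ⟨ha1, ha2⟩, rfl⟩ _ ⟨b, ⟨hb1, hb2⟩, rfl⟩
  have i1 := dist_triangle4 (f a) (g a) (g b) (f b)
  have i2 := dist_triangle_right (g a) (g b) y
  rw [dist_comm (g b) (f b)] at i1
  linarith

theorem regulatedFrom_of_approx {E : Type*} [NormedAddCommGroup E] [CompleteSpace E] {s : ℝ}
    {f : ℝ → E} (h : ∀ ε > 0, ∃ g : ℝ → E, RegulatedFrom s g ∧ ∀ t, s ≤ t → dist (f t) (g t) ≤ ε) :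
    RegulatedFrom s f := by
  refine ⟨fun t ht => exists_tendsto_of_approx fun ε hε => ?_,
    fun t ht => exists_tendsto_of_approx fun ε hε => ?_⟩
  · obtain ⟨g, hg, hfg⟩ := h ε hε
    refine ⟨g, hg.1 t ht, ?_⟩
    filter_upwards [Ioo_mem_nhdsLT ht] with y hy using hfg y hy.1.le
  · obtain ⟨g, hg, hfg⟩ := h ε hε
    refine ⟨g, hg.2 t ht, ?_⟩
    filter_upwards [self_mem_nhdsWithin] with y hy using hfg y (ht.trans (mem_Ioi.1 hy).le)

/-! ### Bounds for integrals of functions in the class `ClassF` -/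

section ClassF

variable {Z : Type*} [NormedAddCommGroup Z] {F : Z → ℝ → Z} {h : ℝ → ℝ} {z z₁ z₂ : ℝ → Z}

theorem HasKurzweilIntegral.norm_classF_le (hF : ClassF F h) {a b : ℝ} {J : Z}
    (hJ : HasKurzweilIntegral (fun τ γ => F (z τ) γ) a b J) (hab : a ≤ b) :
    ‖J‖ ≤ h b - h a := by
  simpa using hJ.norm_sub_le (H := h) (G := fun _ => 0) hab fun u τ v _ h2 h3 _ => by
    simpa using hF.dominatedBy (z τ) u v (h2.trans h3)

theorem HasKurzweilIntegral.norm_sub_classF_le (hF : ClassF F h) {a b M : ℝ} {J₁ J₂ : Z}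
    (hJ₁ : HasKurzweilIntegral (fun τ γ => F (z₁ τ) γ) a b J₁)
    (hJ₂ : HasKurzweilIntegral (fun τ γ => F (z₂ τ) γ) a b J₂) (hab : a ≤ b)
    (hM : ∀ t, a ≤ t → ‖z₁ t - z₂ t‖ ≤ M) : ‖J₁ - J₂‖ ≤ M * h b - M * h a := by
  simpa using (hJ₁.sub hJ₂).norm_sub_le (H := fun v => M * h v) (G := fun _ => 0) hab
    fun u τ v h1 h2 h3 _ => by
      rw [sub_zero, sub_zero, sub_sub_sub_comm]
      exact hF.lipschitz_of_le _ _ (h2.trans h3) (hM τ (h1.trans h2))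

end ClassF

/-! ### The Lyapunov-Perron operator: estimates and fixed point -/

section LyapunovPerron

variable {Z : Type*} [NormedAddCommGroup Z] [NormedSpace ℝ Z]
  {Λ : ℝ → Z →L[ℝ] Z} {V : ℝ → ℝ → Z →L[ℝ] Z} {P : ℝ → Z →L[ℝ] Z} {F : Z → ℝ → Z} {h : ℝ → ℝ}
  {K α Ca ε s : ℝ} {VΛ : ℝ≥0} {ζ ζ₁ ζ₂ : Z} {z w z₁ z₂ w₁ w₂ f : ℝ → Z}

theorem IsExpDichotomy.norm_stable_le (hP : IsExpDichotomy V P K α) (hK : 0 < K) (hα : 0 < α)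
    {t σ : ℝ} (h : σ ≤ t) : ‖V t σ * P σ‖ ≤ K := by
  refine (hP.stable t σ h).trans (mul_le_of_le_one_right hK.le (Real.exp_le_one_iff.2 ?_))
  nlinarith

theorem IsExpDichotomy.norm_proj_le (hP : IsExpDichotomy V P K α)
    (hV : IsFundamentalOperator Λ V) (t : ℝ) : ‖P t‖ ≤ K := by
  simpa [hV.self] using hP.stable t t le_rfl

theorem IsExpDichotomy.norm_unstable_le (hP : IsExpDichotomy V P K α)
    (hV : IsFundamentalOperator Λ V) (hK : 0 < K) (hα : 0 < α)
    {t σ : ℝ} (h : t ≤ σ) : ‖V t σ * (1 - P σ)‖ ≤ 1 + K := by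
  rcases h.lt_or_eq with h | rfl
  · refine (hP.unstable t σ h).trans ((mul_le_of_le_one_right hK.le
      (Real.exp_le_one_iff.2 ?_)).trans (by linarith))
    nlinarith
  -- The unstable estimate is assumed only for `t < σ`. On the diagonal the bound comes from `‖P t‖
  -- ≤ K`, which is why the constant is `1 + K`.
  · rw [hV.self, one_mul]
    have h1 : ‖(1 : Z →L[ℝ] Z)‖ ≤ 1 := ContinuousLinearMap.norm_id_le
    linarith [norm_sub_le 1 (P t), hP.norm_proj_le hV t]

/-- Two boundary terms and one variation term, each at most `C * R`. -/
theorem norm_stieltjes_le_three_mul {A : ℝ → Z →L[ℝ] Z} {a b C R : ℝ} {J : Z}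
    (hJ : HasKurzweilIntegral (fun τ γ => A γ (f τ)) a b J)
    (hab : a ≤ b) (hA : ∀ γ, a ≤ γ → γ ≤ b → ‖A γ‖ ≤ C)
    (hf : ∀ u v, a ≤ u → u ≤ v → v ≤ b → ‖f v - f u‖ ≤ h v - h u)
    (hR : h b - h a ≤ R) (hfa : ‖f a‖ ≤ R) (hfb : ‖f b‖ ≤ R) : ‖J‖ ≤ 3 * (C * R) := by
  have hC : 0 ≤ C := (norm_nonneg _).trans (hA a le_rfl hab)
  have i1 := norm_stieltjes_le hJ hab hA hf
  have i2 := (A b).le_of_opNorm_le_of_le (hA b hab le_rfl) hfb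
  have i3 := (A a).le_of_opNorm_le_of_le (hA a le_rfl hab) hfa
  have i4 := norm_add_le (J - (A b (f b) - A a (f a))) (A b (f b) - A a (f a))
  have i5 := norm_sub_le (A b (f b)) (A a (f a))
  have i6 := mul_le_mul_of_nonneg_left hR hC
  rw [sub_add_cancel] at i4
  linarith

/-- Only the stable component of `ζ` enters, so `ζ` and `z s` can be exchanged when these agree;
this links fixed points of `𝒥_ζ` to the Lyapunov-Perron equation. -/
theorem IsLyapunovPerronImage.congr {z' w' : ℝ → Z}
    (hw : IsLyapunovPerronImage V P F s ζ₁ z w) (hζ : P s ζ₁ = P s ζ₂)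
    (hz : ∀ t, s ≤ t → z t = z' t) (hw' : ∀ t, s ≤ t → w t = w' t) :
    IsLyapunovPerronImage V P F s ζ₂ z' w' := by
  obtain ⟨f, hf, H⟩ := hw
  refine ⟨f, fun σ hσ => (hf σ hσ).congr fun τ hτ γ _ => by rw [hz τ hτ.1], fun t ht => ?_⟩
  obtain ⟨I₁, I₂, h1, h2, h3⟩ := H t ht
  exact ⟨I₁, I₂, h1, h2, by rw [← hw' t ht, h3, hζ]⟩

theorem isLyapunovPerronImage_zero (hF0 : ∀ t, F 0 t = 0) :
    IsLyapunovPerronImage V P F s 0 (fun _ => 0) (fun _ => 0) :=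
  ⟨fun _ => 0, fun σ _ => hasKurzweilIntegral_zero (fun _ γ => hF0 γ) s σ, fun t _ =>
    ⟨0, 0, hasKurzweilIntegral_zero (by simp) _ _,
      ⟨fun _ => 0, fun T _ => hasKurzweilIntegral_zero (by simp) _ _, tendsto_const_nhds⟩,
      by simp⟩⟩

/-- Lipschitz dependence of the Lyapunov-Perron operator on `ζ` and `z`. -/
theorem IsLyapunovPerronImage.norm_sub_le (hV : IsFundamentalOperator Λ V)
    (hP : IsExpDichotomy V P K α) (hK : 0 < K) (hα : 0 < α) (hF : ClassF F h)
    (hε : ∀ a b, a ≤ b → h b - h a ≤ ε)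
    (hw₁ : IsLyapunovPerronImage V P F s ζ₁ z₁ w₁) (hw₂ : IsLyapunovPerronImage V P F s ζ₂ z₂ w₂)
    {M : ℝ} (hM : ∀ t, s ≤ t → ‖z₁ t - z₂ t‖ ≤ M) {t : ℝ} (ht : s ≤ t) :
    ‖w₁ t - w₂ t‖ ≤ K * ‖ζ₁ - ζ₂‖ + (4 + 6 * K) * ε * M := by
  obtain ⟨f₁, hf₁, H₁⟩ := hw₁
  obtain ⟨f₂, hf₂, H₂⟩ := hw₂
  obtain ⟨I₁, I₂, h1, ⟨g₁, hg₁, hI₂⟩, h3⟩ := H₁ t ht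
  obtain ⟨J₁, J₂, k1, ⟨g₂, hg₂, hJ₂⟩, k3⟩ := H₂ t ht
  have hM0 : 0 ≤ M := (norm_nonneg _).trans (hM s le_rfl)
  -- The integrals are linear in the primitive, so only `g` has to be estimated: it vanishes at `s`,
  -- and its size and increments are at most `ε * M`.
  set g : ℝ → Z := fun τ => f₁ τ - f₂ τ with hg
  have hgs : g s = 0 := by
    rw [hg]
    simp only [(hf₁ s le_rfl).unique (hasKurzweilIntegral_self _ s) le_rfl,
      (hf₂ s le_rfl).unique (hasKurzweilIntegral_self _ s) le_rfl, sub_zero]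
  have hgd : ∀ u v, s ≤ u → u ≤ v → ‖g v - g u‖ ≤ M * h v - M * h u := by
    intro u v hu huv
    rw [show g v - g u = (f₁ v - f₁ u) - (f₂ v - f₂ u) from sub_sub_sub_comm _ _ _ _]
    exact ((hf₁ u hu).sub_left (hf₁ v (hu.trans huv)) hu).norm_sub_classF_le hF
      ((hf₂ u hu).sub_left (hf₂ v (hu.trans huv)) hu) huv fun t ht => hM t (hu.trans ht)
  have hR : ∀ a b, a ≤ b → M * h b - M * h a ≤ ε * M := fun a b hab => by
    nlinarith [hε a b hab]
  have hgR : ∀ u, s ≤ u → ‖g u‖ ≤ ε * M := fun u hu => by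
    simpa [hgs] using (hgd s u le_rfl hu).trans (hR s u hu)
  have b1 : ‖I₁ - J₁‖ ≤ 3 * (K * (ε * M)) := by
    refine norm_stieltjes_le_three_mul (f := g) (A := fun γ => V t γ * P γ)
      (h := fun v => M * h v) ?_ ht
      (fun γ _ hγ => hP.norm_stable_le hK hα hγ) (fun u v hu huv _ => hgd u v hu huv)
      (hR s t ht) (hgR s le_rfl) (hgR t ht)
    simpa only [hg, map_sub] using h1.sub k1
  have b2 : ‖I₂ - J₂‖ ≤ 3 * ((1 + K) * (ε * M)) := by
    -- The bound on `[t, T]` is uniform in `T`, hence survives the limit.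
    refine le_of_tendsto (hI₂.sub hJ₂).norm ?_
    filter_upwards [eventually_ge_atTop t] with T hT
    refine norm_stieltjes_le_three_mul (f := g) (A := fun γ => V t γ * (1 - P γ))
      (h := fun v => M * h v) ?_ hT
      (fun γ hγ _ => hP.norm_unstable_le hV hK hα hγ)
      (fun u v hu huv _ => hgd u v (ht.trans hu) huv)
      (hR t T hT) (hgR t ht) (hgR T (ht.trans hT))
    simpa only [hg, map_sub] using (hg₁ T hT).sub (hg₂ T hT)
  have b3 : ‖(V t s * P s) (ζ₁ - ζ₂)‖ ≤ K * ‖ζ₁ - ζ₂‖ :=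
    (V t s * P s).le_of_opNorm_le (hP.norm_stable_le hK hα ht) _
  have e : w₁ t - w₂ t = (V t s * P s) (ζ₁ - ζ₂) + g t - (I₁ - J₁) + (I₂ - J₂) := by
    rw [h3, k3, map_sub, mul_apply_eq_comp, mul_apply_eq_comp,
      show g t = f₁ t - f₂ t from rfl]
    abel
  rw [e]
  have c1 := norm_add_le ((V t s * P s) (ζ₁ - ζ₂) + g t - (I₁ - J₁)) (I₂ - J₂)
  have c2 := _root_.norm_sub_le ((V t s * P s) (ζ₁ - ζ₂) + g t) (I₁ - J₁)
  have c3 := norm_add_le ((V t s * P s) (ζ₁ - ζ₂)) (g t)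
  have c4 := hgR t ht
  linarith

/-- The image under the Lyapunov-Perron operator has stable component `ζ` at time `s`. -/
theorem IsLyapunovPerronImage.proj_eq (hV : IsFundamentalOperator Λ V)
    (hP : IsExpDichotomy V P K α) (hw : IsLyapunovPerronImage V P F s ζ z w) :
    P s (w s) = P s ζ := by
  obtain ⟨f, hf, H⟩ := hw
  obtain ⟨I₁, I₂, h1, ⟨g, hg, hI₂⟩, h3⟩ := H s le_rfl
  have hP' : ∀ t x, P t (P t x) = P t x := fun t x => by
    rw [← mul_apply_eq_comp, hP.proj]
  -- By invariance `P(s)V(s,γ)(1 - P(γ)) = V(s,γ)P(γ)(1 - P(γ)) = 0`, so `P s` annihilates the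
  -- unstable integral.
  have hz : P s I₂ = 0 := by
    refine tendsto_nhds_unique (((P s).continuous.tendsto I₂).comp hI₂)
      (tendsto_const_nhds.congr' ?_)
    filter_upwards [eventually_ge_atTop s] with T hT
    refine (hasKurzweilIntegral_zero (fun τ γ => ?_) s T).unique ((hg T hT).map_clm (P s)) hT
    rw [← mul_apply_eq_comp, ← mul_assoc, hP.invariant, mul_assoc, mul_sub, mul_one,
      hP.proj]
    simp
  rw [h3, (hf s le_rfl).unique (hasKurzweilIntegral_self _ s) le_rfl,
    h1.unique (hasKurzweilIntegral_self _ s) le_rfl, hV.self]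
  simp [hz, hP']

/-- Since `F 0 = 0`, the zero function is its own image for `ζ = 0`; comparison with it gives the
bound. -/
theorem IsLyapunovPerronImage.boundedFrom (hV : IsFundamentalOperator Λ V)
    (hP : IsExpDichotomy V P K α) (hK : 0 < K) (hα : 0 < α) (hF : ClassF F h)
    (hF0 : ∀ t, F 0 t = 0) (hε : ∀ a b, a ≤ b → h b - h a ≤ ε)
    (hw : IsLyapunovPerronImage V P F s ζ z w) (hz : BoundedFrom s z) : BoundedFrom s w := by
  obtain ⟨M, hM⟩ := hz
  refine ⟨K * ‖ζ‖ + (4 + 6 * K) * ε * M, fun t ht => ?_⟩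
  simpa using hw.norm_sub_le hV hP hK hα hF hε (isLyapunovPerronImage_zero hF0)
    (M := M) (by simpa using hM) ht

/-- Bounded fixed points depend on `ζ` in a Lipschitz way; in particular they are unique. -/
theorem IsLyapunovPerronImage.norm_fixed_sub_le (hV : IsFundamentalOperator Λ V)
    (hP : IsExpDichotomy V P K α) (hK : 0 < K) (hα : 0 < α) (hF : ClassF F h)
    (hε : ∀ a b, a ≤ b → h b - h a ≤ ε) (hεK : (4 + 6 * K) * ε = 1 / 2)
    (h₁ : IsLyapunovPerronImage V P F s ζ₁ z₁ z₁) (h₂ : IsLyapunovPerronImage V P F s ζ₂ z₂ z₂)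
    (hb₁ : BoundedFrom s z₁) (hb₂ : BoundedFrom s z₂) {t : ℝ} (ht : s ≤ t) :
    ‖z₁ t - z₂ t‖ ≤ 2 * K * ‖ζ₁ - ζ₂‖ := by
  obtain ⟨M₁, hM₁⟩ := hb₁
  obtain ⟨M₂, hM₂⟩ := hb₂
  -- Each use of the Lipschitz estimate turns a bound `B` into `K‖ζ₁ - ζ₂‖ + B/2`, whose fixed value
  -- is `2K‖ζ₁ - ζ₂‖`; the initial excess is halved.
  have key : ∀ n : ℕ, ∀ t, s ≤ t →
      ‖z₁ t - z₂ t‖ ≤ 2 * K * ‖ζ₁ - ζ₂‖ + (M₁ + M₂) * (1 / 2) ^ n := by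
    intro n
    induction n with
    | zero =>
      intro t ht
      have : 0 ≤ 2 * K * ‖ζ₁ - ζ₂‖ := by positivity
      rw [pow_zero, mul_one]
      linarith [_root_.norm_sub_le (z₁ t) (z₂ t), hM₁ t ht, hM₂ t ht]
    | succ n ih =>
      intro t ht
      have := h₁.norm_sub_le hV hP hK hα hF hε h₂ ih ht
      rw [hεK] at this
      rw [pow_succ]
      linarith
  have hlim : Tendsto (fun n : ℕ => 2 * K * ‖ζ₁ - ζ₂‖ + (M₁ + M₂) * (1 / 2 : ℝ) ^ n) atTop
      (𝓝 (2 * K * ‖ζ₁ - ζ₂‖)) := by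
    simpa using ((tendsto_pow_atTop_nhds_zero_of_lt_one (by norm_num : (0 : ℝ) ≤ 1 / 2)
      (by norm_num)).const_mul (M₁ + M₂)).const_add (2 * K * ‖ζ₁ - ζ₂‖)
  exact ge_of_tendsto' hlim fun n => key n t ht

variable [CompleteSpace Z]

/-- The cocycle law `V(t,γ) = V(t,s)V(s,γ)` pulls `t` out of both integrals. They become `V(t,s)`
applied to primitives independent of `t`, which gives existence and regulatedness in `t` at once. -/
theorem exists_regulated_integral_terms (hΛ : LinearHyp Λ Ca VΛ) (hV : IsFundamentalOperator Λ V)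
    (hP : IsExpDichotomy V P K α) (hα : 0 < α) (hf : DominatedBy f h)
    (hε : ∀ a b, a ≤ b → h b - h a ≤ ε) (s : ℝ) :
    ∃ r : ℝ → Z, Regulated r ∧ ∀ t, s ≤ t → ∃ I₁ I₂ : Z,
      HasKurzweilIntegral (fun τ γ => (V t γ * P γ) (f τ)) s t I₁ ∧
      HasImproperKurzweilIntegral (fun τ γ => (V t γ * (1 - P γ)) (f τ)) t I₂ ∧
      r t = f t - I₁ + I₂ := by
  have hPr := hP.regulated hV hΛ
  obtain ⟨g₁, hg₁r, hg₁s, hg₁⟩ := exists_primitive_stieltjes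
    ((hV.regulated_snd hΛ s).mul hPr) hf s
  obtain ⟨g₂, hg₂r, hg₂s, hg₂⟩ := exists_primitive_stieltjes
    ((hV.regulated_snd hΛ s).mul ((regulated_const 1).sub hPr)) hf s
  have hε0 : 0 ≤ ε := by simpa using hε 0 0 le_rfl
  -- On `[N, T]` the kernel `V(s,γ)(1 - P(γ))` is at most `K e^{α(s-N)}`, while `f` is bounded with
  -- increments of `h` at most `ε`; so the tails are exponentially small.
  obtain ⟨G, hG⟩ : ∃ G, Tendsto g₂ atTop (𝓝 G) := by
    refine cauchySeq_tendsto_of_complete (Metric.cauchySeq_iff'.2 fun η hη => ?_)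
    set R := ‖f s‖ + ε with hR
    have hfR : ∀ t, s ≤ t → ‖f t‖ ≤ R := fun t ht => by
      have i1 := _root_.norm_sub_le (f t - f s) (-f s)
      rw [norm_neg, sub_neg_eq_add, sub_add_cancel] at i1
      linarith [(hf s t ht).trans (hε s t ht)]
    have hlim : Tendsto (fun T : ℝ => 3 * (K * Real.exp (α * (s - T)) * R)) atTop (𝓝 0) := by
      have h1 : Tendsto (fun T : ℝ => α * (s - T)) atTop atBot :=
        (tendsto_const_nhds.add_atBot tendsto_neg_atTop_atBot).const_mul_atBot hα
      simpa using (((Real.tendsto_exp_atBot.comp h1).const_mul K).mul_const R).const_mul 3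
    obtain ⟨N, hN1, hN2⟩ := ((hlim.eventually_lt_const hη).and (eventually_gt_atTop s)).exists
    refine ⟨N, fun T hT => ?_⟩
    rw [dist_eq_norm]
    refine (norm_stieltjes_le_three_mul (hg₂ N T hT) hT (fun γ h1 h2 => ?_)
      (fun u v _ huv _ => hf u v huv) ((hε N T hT).trans (by rw [hR]; linarith [norm_nonneg (f s)]))
      (hfR N hN2.le) (hfR T (hN2.le.trans hT))).trans_lt hN1
    refine (hP.unstable s γ (hN2.trans_le h1)).trans ?_
    have hK : 0 ≤ K := (norm_nonneg _).trans (hP.norm_proj_le hV s)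
    gcongr
  have conv : ∀ t γ x, V t s ((V s γ * P γ) x) = (V t γ * P γ) x := fun t γ x => by
    rw [← mul_apply_eq_comp, ← mul_assoc, hV.cocycle hΛ]
  have conv' : ∀ t γ x, V t s ((V s γ * (1 - P γ)) x) = (V t γ * (1 - P γ)) x := fun t γ x => by
    rw [← mul_apply_eq_comp, ← mul_assoc, hV.cocycle hΛ]
  refine ⟨fun t => f t - V t s (g₁ t - g₁ s) + V t s (G - g₂ t),
    (hf.regulated.sub ((hV.regulated hΛ s).clm_apply (hg₁r.sub (regulated_const _)))).add
    ((hV.regulated hΛ s).clm_apply ((regulated_const G).sub hg₂r)), fun t ht =>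
    ⟨V t s (g₁ t - g₁ s), V t s (G - g₂ t), ?_, ⟨fun T => V t s (g₂ T - g₂ t), fun T hT => ?_, ?_⟩,
    rfl⟩⟩
  · simpa only [conv] using (hg₁ s t ht).map_clm (V t s)
  · simpa only [conv'] using (hg₂ t T hT).map_clm (V t s)
  · exact ((V t s).continuous.tendsto _).comp (hG.sub_const _)

theorem exists_isLyapunovPerronImage (hΛ : LinearHyp Λ Ca VΛ) (hV : IsFundamentalOperator Λ V)
    (hP : IsExpDichotomy V P K α) (hα : 0 < α) (hF : ClassF F h)
    (hε : ∀ a b, a ≤ b → h b - h a ≤ ε) (ζ : Z) (hz : RegulatedFrom s z) :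
    ∃ w, IsLyapunovPerronImage V P F s ζ z w := by
  obtain ⟨f, hfs, hf⟩ := exists_primitive
    (fun u v huv => hF.exists_hasKurzweilIntegral hz.regulated huv) s
  have hfd : DominatedBy f h := fun a b hab => (hf a b hab).norm_classF_le hF hab
  obtain ⟨r, -, H⟩ := exists_regulated_integral_terms hΛ hV hP hα hfd hε s
  refine ⟨fun t => V t s (P s ζ) + r t, f, fun σ hσ => ?_, fun t ht => ?_⟩
  · have := hf s σ hσ
    rw [hfs, sub_zero] at this
    exact this.congr fun τ hτ γ _ => by rw [max_eq_right hτ.1]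
  · obtain ⟨I₁, I₂, h1, h2, h3⟩ := H t ht
    exact ⟨I₁, I₂, h1, h2, by dsimp only; rw [h3]; abel⟩

/-- No regularity of `z` is needed: once the integrals defining `f` exist, `f` is dominated by `h`,
and the integral terms coincide by uniqueness with the regulated ones already constructed. -/
theorem IsLyapunovPerronImage.regulatedFrom (hΛ : LinearHyp Λ Ca VΛ)
    (hV : IsFundamentalOperator Λ V) (hP : IsExpDichotomy V P K α) (hα : 0 < α) (hF : ClassF F h)
    (hε : ∀ a b, a ≤ b → h b - h a ≤ ε) (hw : IsLyapunovPerronImage V P F s ζ z w) :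
    RegulatedFrom s w := by
  obtain ⟨f, hf, H⟩ := hw
  have hfd : DominatedBy (fun t => f (max s t)) h := by
    intro a b hab
    have i1 := ((hf _ (le_max_left s a)).sub_left (hf _ (le_max_left s b))
      (le_max_left s a)).norm_classF_le hF (max_le_max le_rfl hab)
    refine i1.trans ?_
    rcases le_total s a with ha | ha
    · rw [max_eq_right ha, max_eq_right (ha.trans hab)]
    · rw [max_eq_left ha]
      rcases le_total s b with hb | hb
      · rw [max_eq_right hb]
        linarith [hF.mono ha]
      · rw [max_eq_left hb]
        linarith [hF.mono hab]
  obtain ⟨r, hr, H'⟩ := exists_regulated_integral_terms hΛ hV hP hα hfd hε s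
  refine RegulatedFrom.congr ((((hV.regulated hΛ s).clm_apply
    (regulated_const (P s ζ))).add hr).regulatedFrom s) fun t ht => ?_
  obtain ⟨I₁, I₂, h1, h2, h3⟩ := H t ht
  obtain ⟨J₁, J₂, k1, ⟨g, hg, hJ₂⟩, k3⟩ := H' t ht
  have e1 : I₁ = J₁ :=
    h1.unique (k1.congr fun τ hτ γ _ => by rw [max_eq_right hτ.1]) ht
  have e2 : I₂ = J₂ := h2.unique ⟨g, fun T hT =>
    (hg T hT).congr fun τ hτ γ _ => by rw [max_eq_right (ht.trans hτ.1)], hJ₂⟩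
  rw [h3, k3, e1, e2, max_eq_right ht]
  abel

/-- The Lyapunov-Perron operator has a bounded regulated fixed point. -/
theorem exists_fixed (hΛ : LinearHyp Λ Ca VΛ) (hV : IsFundamentalOperator Λ V)
    (hP : IsExpDichotomy V P K α) (hK : 0 < K) (hα : 0 < α) (hF : ClassF F h)
    (hF0 : ∀ t, F 0 t = 0) (hε : ∀ a b, a ≤ b → h b - h a ≤ ε)
    (hεK : (4 + 6 * K) * ε = 1 / 2) (s : ℝ) (ζ : Z) :
    ∃ φ : ℝ → Z, BoundedFrom s φ ∧ RegulatedFrom s φ ∧ IsLyapunovPerronImage V P F s ζ φ φ := by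
  have hT : ∀ z : {z : ℝ → Z // BoundedFrom s z ∧ RegulatedFrom s z},
      ∃ w : {z : ℝ → Z // BoundedFrom s z ∧ RegulatedFrom s z},
        IsLyapunovPerronImage V P F s ζ z.1 w.1 := by
    rintro ⟨z, hzb, hzr⟩
    obtain ⟨w, hw⟩ := exists_isLyapunovPerronImage hΛ hV hP hα hF hε ζ hzr
    exact ⟨⟨w, hw.boundedFrom hV hP hK hα hF hF0 hε hzb,
      hw.regulatedFrom hΛ hV hP hα hF hε⟩, hw⟩
  choose T hT using hT
  have contr : ∀ z₁ z₂ M, (∀ t, s ≤ t → ‖z₁.1 t - z₂.1 t‖ ≤ M) →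
      ∀ t, s ≤ t → ‖(T z₁).1 t - (T z₂).1 t‖ ≤ 1 / 2 * M := by
    intro z₁ z₂ M hM t ht
    simpa [hεK] using (hT z₁).norm_sub_le hV hP hK hα hF hε (hT z₂) hM ht
  -- Picard iteration from zero. An image is determined only on `[s, ∞)`, so all convergence
  -- statements are restricted to that half-line.
  let u : ℕ → {z : ℝ → Z // BoundedFrom s z ∧ RegulatedFrom s z} :=
    fun n => T^[n] ⟨fun _ => 0, ⟨0, by simp⟩, (regulated_const 0).regulatedFrom s⟩
  have hu : ∀ n, u (n + 1) = T (u n) := fun n => Function.iterate_succ_apply' T n _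
  obtain ⟨M, hM⟩ := (u 1).2.1
  have hgeo : ∀ n : ℕ, ∀ t, s ≤ t → ‖(u n).1 t - (u (n + 1)).1 t‖ ≤ M * (1 / 2) ^ n := by
    intro n
    induction n with
    | zero => intro t ht; simpa [u] using hM t ht
    | succ n ih =>
      intro t ht
      rw [hu n, hu (n + 1), pow_succ]
      linarith [contr _ _ _ ih t ht]
  have hlim : ∀ t, ∃ y, s ≤ t → Tendsto (fun n => (u n).1 t) atTop (𝓝 y) := by
    intro t
    by_cases ht : s ≤ t
    · obtain ⟨y, hy⟩ := cauchySeq_tendsto_of_complete (cauchySeq_of_le_geometric (1 / 2) M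
        (by norm_num) fun n => (dist_eq_norm _ _).trans_le (hgeo n t ht))
      exact ⟨y, fun _ => hy⟩
    · exact ⟨0, fun h => absurd h ht⟩
  choose φ hφ using hlim
  have hdist : ∀ n : ℕ, ∀ t, s ≤ t → ‖(u n).1 t - φ t‖ ≤ 2 * M * (1 / 2) ^ n := by
    intro n t ht
    have := dist_le_of_le_geometric_of_tendsto (1 / 2) M (by norm_num)
      (fun n => (dist_eq_norm _ _).trans_le (hgeo n t ht)) (hφ t ht) n
    rw [dist_eq_norm] at this
    refine this.trans (le_of_eq ?_)
    ring
  have hpow : Tendsto (fun n : ℕ => 2 * M * (1 / 2 : ℝ) ^ n) atTop (𝓝 0) := by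
    simpa using (tendsto_pow_atTop_nhds_zero_of_lt_one (by norm_num : (0 : ℝ) ≤ 1 / 2)
      (by norm_num)).const_mul (2 * M)
  have hφb : BoundedFrom s φ := by
    refine ⟨2 * M, fun t ht => ?_⟩
    simpa [u] using hdist 0 t ht
  -- Uniform limits of regulated functions are regulated.
  have hφr : RegulatedFrom s φ := by
    refine regulatedFrom_of_approx fun η hη => ?_
    obtain ⟨n, hn⟩ := (hpow.eventually_lt_const hη).exists
    refine ⟨(u n).1, (u n).2.2, fun t ht => ?_⟩
    rw [dist_comm, dist_eq_norm]
    exact (hdist n t ht).trans hn.le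
  refine ⟨φ, hφb, hφr, (hT ⟨φ, hφb, hφr⟩).congr rfl (fun _ _ => rfl) fun t ht => ?_⟩
  -- The sequence `u (n + 1) = T (u n)` converges both to `T φ`, by contraction, and to `φ`.
  refine tendsto_nhds_unique (tendsto_iff_norm_sub_tendsto_zero.2 ?_)
    ((tendsto_add_atTop_iff_nat 1).2 (hφ t ht))
  refine squeeze_zero (fun _ => norm_nonneg _) (fun n => ?_)
    (by simpa only [mul_zero] using hpow.const_mul (1 / 2))
  rw [hu]
  exact contr (u n) ⟨φ, hφb, hφr⟩ _ (hdist n) t ht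

end LyapunovPerron

end GODE

/-! ### The main theorem -/

theorem lemma3p4 (K α Ca : ℝ) (VΛ : ℝ≥0) (hK : 0 < K) (hα : 0 < α) (hCa : 0 < Ca) :
    ∃ ε > (0 : ℝ), ∃ q : ℝ, 0 ≤ q ∧ q < 1 ∧ ∃ L : ℝ, 0 ≤ L ∧
      ∀ (Z : Type*) [NormedAddCommGroup Z] [NormedSpace ℝ Z] [CompleteSpace Z]
        (Λ : ℝ → Z →L[ℝ] Z) (V : ℝ → ℝ → Z →L[ℝ] Z) (P : ℝ → Z →L[ℝ] Z)
        (F : Z → ℝ → Z) (h : ℝ → ℝ),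
        GODE.LinearHyp Λ Ca VΛ →
        GODE.IsFundamentalOperator Λ V →
        GODE.IsExpDichotomy V P K α →
        (∀ t, F 0 t = 0) →
        GODE.ClassF F h →
        GODE.totalVariation h < ENNReal.ofReal ε →
        -- the Lyapunov-Perron operator maps bounded regulated functions to such functions
        (∀ (s : ℝ) (ζ : Z), ζ ∈ GODE.stableSpace P s → ∀ z : ℝ → Z,
          GODE.BoundedFrom s z → GODE.RegulatedFrom s z →
          ∃ w : ℝ → Z, GODE.BoundedFrom s w ∧ GODE.RegulatedFrom s w ∧
            GODE.IsLyapunovPerronImage V P F s ζ z w) ∧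
        -- it is a contraction in the supremum norm, uniformly in `s` and `ζ`
        (∀ (s : ℝ) (ζ : Z), ζ ∈ GODE.stableSpace P s → ∀ z₁ z₂ w₁ w₂ : ℝ → Z,
          GODE.BoundedFrom s z₁ → GODE.RegulatedFrom s z₁ →
          GODE.BoundedFrom s z₂ → GODE.RegulatedFrom s z₂ →
          GODE.IsLyapunovPerronImage V P F s ζ z₁ w₁ →
          GODE.IsLyapunovPerronImage V P F s ζ z₂ w₂ →
          ∀ M : ℝ, (∀ t, s ≤ t → ‖z₁ t - z₂ t‖ ≤ M) → ∀ t, s ≤ t → ‖w₁ t - w₂ t‖ ≤ q * M) ∧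
        -- `φ s ζ` is its fixed point and the unique bounded solution with `P(s) z(s) = ζ`
        ∃ φ : ℝ → Z → ℝ → Z,
          (∀ (s : ℝ) (ζ : Z), ζ ∈ GODE.stableSpace P s →
            GODE.IsBoundedLyapunovPerronSolution V P F s ζ (φ s ζ) ∧
            GODE.RegulatedFrom s (φ s ζ) ∧
            GODE.IsLyapunovPerronImage V P F s ζ (φ s ζ) (φ s ζ) ∧
            ∀ z : ℝ → Z, GODE.IsBoundedLyapunovPerronSolution V P F s ζ z →
              EqOn z (φ s ζ) (Ici s)) ∧
          (∀ s t : ℝ, s ≤ t → φ s 0 t = 0) ∧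
          (∀ (s : ℝ) (ζ₁ ζ₂ : Z), ζ₁ ∈ GODE.stableSpace P s → ζ₂ ∈ GODE.stableSpace P s →
            ∀ t : ℝ, s ≤ t → ‖φ s ζ₁ t - φ s ζ₂ t‖ ≤ L * ‖ζ₁ - ζ₂‖) := by
  have hC : 0 < 4 + 6 * K := by linarith
  -- `ε` is chosen to make the contraction factor `(4 + 6K)ε` equal to `1/2`; then `L = K / (1 -
  -- 1/2)`.
  refine ⟨1 / (2 * (4 + 6 * K)), by positivity, 1 / 2, by norm_num, by norm_num, 2 * K,
    by linarith, ?_⟩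
  intro Z _ _ _ Λ V P F h hΛ hV hP hF0 hF hvar
  have hε := fun a b => GODE.sub_le_of_totalVariation_lt (a := a) (b := b) hvar
  have hεK : (4 + 6 * K) * (1 / (2 * (4 + 6 * K))) = 1 / 2 := by field_simp
  have hproj : ∀ s ζ, ζ ∈ GODE.stableSpace P s → P s ζ = ζ := by
    rintro s _ ⟨ζ, rfl⟩
    exact congrArg (fun T : Z →L[ℝ] Z => T ζ) (hP.proj s)
  refine ⟨fun s ζ _ z hzb hzr => ?_, fun s ζ _ z₁ z₂ w₁ w₂ _ _ _ _ h₁ h₂ M hM t ht => ?_, ?_⟩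
  · obtain ⟨w, hw⟩ := GODE.exists_isLyapunovPerronImage hΛ hV hP hα hF hε ζ hzr
    exact ⟨w, hw.boundedFrom hV hP hK hα hF hF0 hε hzb,
      hw.regulatedFrom hΛ hV hP hα hF hε, hw⟩
  · have := h₁.norm_sub_le hV hP hK hα hF hε h₂ hM ht
    rwa [sub_self, norm_zero, mul_zero, zero_add, hεK] at this
  · choose φ hφb hφr hφ using GODE.exists_fixed hΛ hV hP hK hα hF hF0 hε hεK
    refine ⟨φ, fun s ζ hζ => ⟨⟨hφb s ζ, ?_, ?_⟩, hφr s ζ, hφ s ζ, ?_⟩, fun s t ht => ?_,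
      fun s ζ₁ ζ₂ _ _ t ht => ?_⟩
    · exact (hφ s ζ).congr ((hφ s ζ).proj_eq hV hP).symm (fun _ _ => rfl) fun _ _ => rfl
    · exact ((hφ s ζ).proj_eq hV hP).trans (hproj s ζ hζ)
    -- A bounded solution is a fixed point for the parameter `z s`, hence for `ζ`, as both have the
    -- same stable component; two bounded fixed points with equal parameter coincide.
    · rintro z ⟨hzb, hz, hzs⟩ t ht
      have hz' := hz.congr (ζ₂ := ζ) (hzs.trans (hproj s ζ hζ).symm) (fun _ _ => rfl)
        fun _ _ => rfl
      have := hz'.norm_fixed_sub_le hV hP hK hα hF hε hεK (hφ s ζ) hzb (hφb s ζ) ht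
      rw [sub_self, norm_zero, mul_zero] at this
      exact sub_eq_zero.1 (norm_le_zero_iff.1 this)
    · simpa using (hφ s 0).norm_fixed_sub_le hV hP hK hα hF hε hεK
        (GODE.isLyapunovPerronImage_zero hF0) (hφb s 0) ⟨0, by simp⟩ ht
    · exact (hφ s ζ₁).norm_fixed_sub_le hV hP hK hα hF hε hεK (hφ s ζ₂) (hφb s ζ₁) (hφb s ζ₂) ht
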